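/- **Model.** The state of nature is $\theta\in\{H,L\}$ with $\Pr(\theta=H)=p\in(0,1)$. Conditional on $\theta$, signals are i.i.d. on a finite set $S$ with distribution $\pi_\theta$, where $\pi_\theta(s)>0$ for all $s$ and $\theta$, and $\pi_H\neq\pi_L$. A receiver with $m\ge 2$ memory states $M=\{1,\dots,m\}$ commits to a protocol $\Pi=(f,g,a)$, where $f:M\times S\to\Delta(M)$ is a stochastic transition rule, $g\in\Delta(M)$ an initial distribution and $a:M\to[0,1]$ an action rule. The sender observes $\Pi$, $\theta$ and the current memory state, and chooses stopping probabilities $\sigma:M\times\{H,L\}\to[0,1]$. In each period with memory state $i$, the game ends if the sender stops, or if $f(i,s)(i)=1$ for all $s\in S$; otherwise a signal $s$ is drawn from $\pi_\theta$ and the next memory state is drawn from $f(i,s)$. When the game ends in memory state $i$, the action $H$ is taken with probability $a(i)$ and $L$ otherwise. The sender's payoff is $1$ if the action is $H$ and $0$ otherwise; the receiver's payoff is $1$ if the action equals $\theta$ and $0$ otherwise; both get $0$ if the game never ends. Let $U^S(\Pi,\sigma)$ and $U^R(\Pi,\sigma)$ be the expected payoffs, $\mathrm{br}(\Pi)$ the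 set of maximizers of $U^S(\Pi,\cdot)$, and $U^R(\Pi)=\sup_{\sigma\in\mathrm{br}(\Pi)}U^R(\Pi,\sigma)$ (all best responses under which the game ends with probability $1$ give this same payoff). The receiver's optimal payoff is $V=\sup_\Pi U^R(\Pi)$, the supremum over all protocols with $m$ memory states. Put $$\gamma=\frac{\max_{s}\pi_H(s)/\pi_L(s)}{\min_{s}\pi_H(s)/\pi_L(s)},\qquad \kappa=\max\Bigl\{\frac{p}{1-p},\frac{1-p}{p}\Bigr\}.$$ **Corollary.** Fix $p\in(0,1)$. For each $m\ge2$ the optimal payoff depends on the signal structure $(S,\pi_H,\pi_L)$ only through $\gamma$; write it as $V(\gamma,m)$. Then: (i) If $\gamma^{m-2}>\kappa$, then $V$ is strictly increasing in $\gamma$ and in $m$: whenever $\gamma'\ge\gamma$ and $m'\ge m$ with at least one inequality strict, $V(\gamma,m)<V(\gamma',m')$. For each fixed $m\ge3$, $V(\gamma,m)\to1$ as $\gamma\to\infty$; for each fixed signal structure, $V(\gamma,m)\to1$ as $m\to\infty$. As $\gamma$ and $m\ge 2$ vary so that $\gamma^{m-2}$ tends to $\kappa$ from above, $V(\gamma,m)\to\max\{p,1-p\}$;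 that is, for every $\varepsilon>0$ there is $\delta>0$ such that $|V(\gamma,m)-\max\{p,1-p\}|<\varepsilon$ whenever $\kappa<\gamma^{m-2}<\kappa+\delta$. (ii) If $m\ge2$ and $\gamma^{m-2}\le\kappa$, then $V(\gamma,m)=\max\{p,1-p\}$, and this payoff is attained by a protocol that takes one fixed action in every memory state. -/

import Mathlib

open Filter Topology

universe u v

/-- The state of nature; the same two labels name the receiver's actions. -/
inductive Nature : Type
  | H
  | L

/-- A conditionally i.i.d. signal technology on a finite signal set `S`: `prob θ s` is the
probability of signal `s` in the state of nature `θ`. It has full support and is not constant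
in `θ`. -/
structure SignalStructure (S : Type u) [Fintype S] where
  prob : Nature → S → ℝ
  prob_pos : ∀ θ s, 0 < prob θ s
  sum_prob : ∀ θ, ∑ s, prob θ s = 1
  prob_ne : prob Nature.H ≠ prob Nature.L

/-- The informativeness index: the largest likelihood ratio divided by the smallest one. -/
noncomputable def SignalStructure.gamma {S : Type u} [Fintype S] (E : SignalStructure S) : ℝ :=
  (⨆ s, E.prob Nature.H s / E.prob Nature.L s) / (⨅ s, E.prob Nature.H s / E.prob Nature.L s)

/-- The skewness index of the prior `p`. -/
noncomputable def kappa (p : ℝ) : ℝ := max (p / (1 - p)) ((1 - p) / p)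

/-- A protocol (finite automaton) of the receiver with `m` memory states: a stochastic transition
function `f`, an initial distribution `g`, and an action rule `a`, where `a i` is the probability
of taking the action `H` when the game ends in the memory state `i`. -/
structure Protocol (m : ℕ) (S : Type u) where
  f : Fin m → S → Fin m → ℝ
  f_mem : ∀ i s, f i s ∈ stdSimplex ℝ (Fin m)
  g : Fin m → ℝ
  g_mem : g ∈ stdSimplex ℝ (Fin m)
  a : Fin m → ℝ
  a_mem : ∀ i, a i ∈ Set.Icc (0 : ℝ) 1

/-- A strategy of the sender, who observes the current memory state and the state of nature:
`stopProb i θ` is the probability of stopping the signal process. -/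
structure SenderStrategy (m : ℕ) where
  stopProb : Fin m → Nature → ℝ
  stopProb_mem : ∀ i θ, stopProb i θ ∈ Set.Icc (0 : ℝ) 1

section Game

variable {S : Type u} {m : ℕ}

/-- The memory state `i` ceases to update, whatever the signal. -/
def Protocol.IsAbsorbing (P : Protocol m S) (i : Fin m) : Prop := ∀ s, P.f i s i = 1

open Classical in
/-- The probability that the game ends in a period that begins in the memory state `i`: it ends
for sure if `i` is absorbing, and otherwise if the sender stops. -/
noncomputable def endProb (P : Protocol m S) (σ : SenderStrategy m) (θ : Nature) (i : Fin m) : ℝ :=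
  if P.IsAbsorbing i then 1 else σ.stopProb i θ

theorem endProb_mem (P : Protocol m S) (σ : SenderStrategy m) (θ : Nature) (i : Fin m) :
    endProb P σ θ i ∈ Set.Icc (0 : ℝ) 1 := by
  unfold endProb
  split_ifs
  · simp
  · exact σ.stopProb_mem i θ

variable [Fintype S]

/-- The transition matrix on memory states in the state of nature `θ`, while signals are sent. -/
def transProb (E : SignalStructure S) (P : Protocol m S) (θ : Nature) (i j : Fin m) : ℝ :=
  ∑ s, E.prob θ s * P.f i s j

/-- The probability, in the state of nature `θ`, that the game has not ended before period `t` and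
the memory state at the beginning of period `t` is the given one. -/
noncomputable def alive (E : SignalStructure S) (P : Protocol m S) (σ : SenderStrategy m)
    (θ : Nature) : ℕ → Fin m → ℝ
  | 0 => P.g
  | t + 1 => fun j =>
      ∑ i, alive E P σ θ t i * (1 - endProb P σ θ i) * transProb E P θ i j

/-- The probability, in the state of nature `θ`, that the game ends in the memory state `i` (in
whatever period). The series converges: see `summable_alive_mul_endProb`. -/
noncomputable def endsIn (E : SignalStructure S) (P : Protocol m S) (σ : SenderStrategy m)
    (θ : Nature) (i : Fin m) : ℝ :=
  ∑' t, alive E P σ θ t i * endProb P σ θ i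

/-- The probability, in the state of nature `θ`, that the game ends and the action is `H`. -/
noncomputable def probHigh (E : SignalStructure S) (P : Protocol m S) (σ : SenderStrategy m)
    (θ : Nature) : ℝ :=
  ∑ i, endsIn E P σ θ i * P.a i

/-- The probability, in the state of nature `θ`, that the game ends and the action is `L`. -/
noncomputable def probLow (E : SignalStructure S) (P : Protocol m S) (σ : SenderStrategy m)
    (θ : Nature) : ℝ :=
  ∑ i, endsIn E P σ θ i * (1 - P.a i)

/-- The sender gets 1 if the action is `H`, and 0 otherwise or if the game never ends. The prior
probability of the state of nature `H` is `p`. -/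
noncomputable def senderPayoff (p : ℝ) (E : SignalStructure S) (P : Protocol m S)
    (σ : SenderStrategy m) : ℝ :=
  p * probHigh E P σ Nature.H + (1 - p) * probHigh E P σ Nature.L

/-- The receiver gets 1 if the action matches the state of nature, and 0 otherwise or if the game
never ends. -/
noncomputable def receiverPayoff (p : ℝ) (E : SignalStructure S) (P : Protocol m S)
    (σ : SenderStrategy m) : ℝ :=
  p * probHigh E P σ Nature.H + (1 - p) * probLow E P σ Nature.L

/-- The sender's best responses to a protocol. -/
def bestResponses (p : ℝ) (E : SignalStructure S) (P : Protocol m S) : Set (SenderStrategy m) :=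
  {σ | ∀ τ, senderPayoff p E P τ ≤ senderPayoff p E P σ}

/-- The receiver's payoff from a protocol to which the sender plays a best response. All best
responses under which the game ends with probability 1 give the same payoff, and no best response
gives more. -/
noncomputable def receiverValue (p : ℝ) (E : SignalStructure S) (P : Protocol m S) : ℝ :=
  ⨆ σ : bestResponses p E P, receiverPayoff p E P σ

/-- The receiver's optimal payoff with `m` memory states: the supremum over all protocols. -/
noncomputable def optimalPayoff (p : ℝ) (E : SignalStructure S) (m : ℕ) : ℝ :=
  ⨆ P : Protocol m S, receiverValue p E P

theorem transProb_nonneg (E : SignalStructure S) (P : Protocol m S) (θ : Nature) (i j : Fin m) :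
    0 ≤ transProb E P θ i j :=
  Finset.sum_nonneg fun s _ => mul_nonneg (E.prob_pos θ s).le ((P.f_mem i s).1 j)

theorem sum_transProb (E : SignalStructure S) (P : Protocol m S) (θ : Nature) (i : Fin m) :
    ∑ j, transProb E P θ i j = 1 := by
  unfold transProb
  rw [Finset.sum_comm]
  simp_rw [← Finset.mul_sum, (P.f_mem i _).2, mul_one]
  exact E.sum_prob θ

theorem alive_nonneg (E : SignalStructure S) (P : Protocol m S) (σ : SenderStrategy m)
    (θ : Nature) (t : ℕ) (i : Fin m) : 0 ≤ alive E P σ θ t i := by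
  induction t generalizing i with
  | zero => exact P.g_mem.1 i
  | succ t ih =>
    exact Finset.sum_nonneg fun j _ => mul_nonneg
      (mul_nonneg (ih j) (sub_nonneg.2 (endProb_mem P σ θ j).2)) (transProb_nonneg E P θ j i)

/-- Conservation of probability: up to each period the game is still alive or has ended. -/
theorem sum_ended_add_sum_alive (E : SignalStructure S) (P : Protocol m S) (σ : SenderStrategy m)
    (θ : Nature) (n : ℕ) :
    ∑ t ∈ Finset.range n, ∑ i, alive E P σ θ t i * endProb P σ θ i
      + ∑ i, alive E P σ θ n i = 1 := by
  induction n with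
  | zero => simpa [alive] using P.g_mem.2
  | succ n ih =>
    have h : ∑ j, alive E P σ θ (n + 1) j
        = ∑ i, alive E P σ θ n i * (1 - endProb P σ θ i) := by
      simp only [alive]
      rw [Finset.sum_comm]
      simp_rw [← Finset.mul_sum, sum_transProb, mul_one]
    have h' : ∑ i, alive E P σ θ n i * endProb P σ θ i
        + ∑ i, alive E P σ θ n i * (1 - endProb P σ θ i) = ∑ i, alive E P σ θ n i := by
      rw [← Finset.sum_add_distrib]
      exact Finset.sum_congr rfl fun i _ => by ring
    rw [Finset.sum_range_succ, h, add_assoc, h', ih]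

theorem summable_alive_mul_endProb (E : SignalStructure S) (P : Protocol m S)
    (σ : SenderStrategy m) (θ : Nature) (i : Fin m) :
    Summable fun t => alive E P σ θ t i * endProb P σ θ i := by
  have hnn : ∀ t j, 0 ≤ alive E P σ θ t j * endProb P σ θ j := fun t j =>
    mul_nonneg (alive_nonneg E P σ θ t j) (endProb_mem P σ θ j).1
  refine summable_of_sum_range_le (c := 1) (fun t => hnn t i) fun n => ?_
  have h1 := sum_ended_add_sum_alive E P σ θ n
  have h2 : 0 ≤ ∑ j, alive E P σ θ n j :=
    Finset.sum_nonneg fun j _ => alive_nonneg E P σ θ n j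
  have h3 : ∑ t ∈ Finset.range n, alive E P σ θ t i * endProb P σ θ i
      ≤ ∑ t ∈ Finset.range n, ∑ j, alive E P σ θ t j * endProb P σ θ j :=
    Finset.sum_le_sum fun t _ =>
      Finset.single_le_sum (f := fun j => alive E P σ θ t j * endProb P σ θ j)
        (fun j _ => hnn t j) (Finset.mem_univ i)
  linarith

end Game

/-! Everything rests on `optimalPayoff_eq_frontierValue`. Let x and y be the probabilities of the
action H in the states of nature H and L. The optimal payoff is the maximum of p x + (1 - p)(1 - y)
on the curve x (1 - y) = G y (1 - x) with G = γ^(m-2). The corollary is then calculus in the single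
parameter G.

Upper bound. The sender wants H in both states of nature, so a best response maximizes x and y
separately. In state H it is optimal to stop on some set T of memory states
(`exists_stopping_value`). In state L the sender can imitate this by stopping on the same T, so y is
at least the imitated probability. Now two chains with the same target T are compared. Switching the
rows outside T from one chain to the other, one at a time, multiplies the odds of the action H by at
most γ each (`IsHitting.odds_le_of_row`). This gives γ^(m-|T|), which suffices if |T| ≥ 2. If T is a
single state, both chains end there and the odds agree.

Lower bound. `climbProtocol` requires n = m - 2 rare upward moves, uninterrupted by the opposite
signal, to reach the top. As the upward probability μ tends to 0 with the failure probability of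
order μ^n, the odds of success become proportional to the n-th power of the likelihood ratio, so
every interior point of the curve is approached. -/

/-! ### Hitting problems for finite Markov chains and the odds bound -/

section Chains

variable {ι : Type*}

/-- Every nonempty closed class of the chain `Q` meets `T`. -/
def MeetsClosed (Q : ι → ι → ℝ) (T : Finset ι) : Prop :=
  ∀ R : Finset ι, R.Nonempty → (∀ i ∈ R, ∀ j, Q i j ≠ 0 → j ∈ R) → ∃ i ∈ R, i ∈ T

theorem MeetsClosed.mono {Q : ι → ι → ℝ} {T T' : Finset ι} (h : MeetsClosed Q T) (hT : T ⊆ T') :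
    MeetsClosed Q T' := fun R hR hc =>
  let ⟨i, hi, hi'⟩ := h R hR hc
  ⟨i, hi, hT hi'⟩

/-- A `Q'`-closed class missing `T` would also be `Q`-closed, since outside `T` every transition of
`Q` is one of `Q'`. Rows inside `T` play no role. -/
theorem MeetsClosed.of_support {Q Q' : ι → ι → ℝ} {T : Finset ι} (h : MeetsClosed Q T)
    (hQ : ∀ i, i ∉ T → ∀ j, Q i j ≠ 0 → Q' i j ≠ 0) : MeetsClosed Q' T := by
  intro R hR hc
  by_contra! hn
  obtain ⟨i, hi, hi'⟩ := h R hR fun i hi j hij => hc i hi j (hQ i (hn i hi) j hij)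
  exact hn i hi hi'

variable [Fintype ι]

/-- A stochastic matrix. -/
structure IsStochastic (Q : ι → ι → ℝ) : Prop where
  nonneg : ∀ i j, 0 ≤ Q i j
  sum_eq : ∀ i, ∑ j, Q i j = 1

/-- `u` is harmonic for `Q` outside `T` and equals `b` on `T`. -/
def IsHitting (Q : ι → ι → ℝ) (T : Finset ι) (b u : ι → ℝ) : Prop :=
  (∀ i ∈ T, u i = b i) ∧ ∀ i, i ∉ T → u i = ∑ j, Q i j * u j

/-- The maximum principle. -/
theorem MeetsClosed.le_of_subharmonic {Q : ι → ι → ℝ} {T : Finset ι} (hQ : IsStochastic Q)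
    (hT : MeetsClosed Q T) {z : ι → ℝ} {c : ℝ} (hz : ∀ i, i ∉ T → z i ≤ ∑ j, Q i j * z j)
    (hc : ∀ i ∈ T, z i ≤ c) (i : ι) : z i ≤ c := by
  classical
  have : Nonempty ι := ⟨i⟩
  -- If the maximum exceeded `c`, the set of maximizers would be closed: an average that reaches the
  -- maximum charges only maximizers. It would then meet `T`, where `z ≤ c`.
  obtain ⟨k, -, hk⟩ := Finset.exists_max_image Finset.univ z Finset.univ_nonempty
  by_contra! hi
  have hkc : c < z k := hi.trans_le (hk i (Finset.mem_univ i))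
  obtain ⟨j, hj, hjT⟩ := hT (Finset.univ.filter fun j => z j = z k) ⟨k, by simp⟩ (by
    intro l hl j hlj
    simp only [Finset.mem_filter, Finset.mem_univ, true_and] at hl ⊢
    have hlT : l ∉ T := fun h => absurd (hc l h) (by linarith)
    have h0 : ∑ j, Q l j * (z k - z j) ≤ 0 := by
      have h1 := hz l hlT
      have h2 : ∑ j, Q l j * (z k - z j) = z k - ∑ j, Q l j * z j := by
        simp_rw [mul_sub, Finset.sum_sub_distrib, ← Finset.sum_mul, hQ.sum_eq, one_mul]
      linarith
    have hnn : ∀ j ∈ Finset.univ, 0 ≤ Q l j * (z k - z j) := fun j hj =>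
      mul_nonneg (hQ.nonneg l j) (sub_nonneg.2 (hk j hj))
    have h3 := (Finset.sum_eq_zero_iff_of_nonneg hnn).1
      (le_antisymm h0 (Finset.sum_nonneg hnn)) j (Finset.mem_univ j)
    have h4 := (mul_eq_zero.1 h3).resolve_left hlj
    linarith)
  simp only [Finset.mem_filter, Finset.mem_univ, true_and] at hj
  linarith [hc j hjT]

/-- The minimum principle. -/
theorem MeetsClosed.le_of_superharmonic {Q : ι → ι → ℝ} {T : Finset ι} (hQ : IsStochastic Q)
    (hT : MeetsClosed Q T) {z : ι → ℝ} {c : ℝ} (hz : ∀ i, i ∉ T → ∑ j, Q i j * z j ≤ z i)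
    (hc : ∀ i ∈ T, c ≤ z i) (i : ι) : c ≤ z i := by
  have := hT.le_of_subharmonic (z := fun i => - z i) (c := -c) hQ
    (fun i hi => by simpa using hz i hi) (fun i hi => neg_le_neg (hc i hi)) i
  simpa using this

theorem IsHitting.unique {Q : ι → ι → ℝ} {T : Finset ι} (hQ : IsStochastic Q)
    (hT : MeetsClosed Q T) {b u v : ι → ℝ} (hu : IsHitting Q T b u) (hv : IsHitting Q T b v) :
    u = v := by
  have key : ∀ {u v : ι → ℝ}, IsHitting Q T b u → IsHitting Q T b v → ∀ i, u i ≤ v i := by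
    intro u v hu hv i
    have := hT.le_of_subharmonic (z := fun i => u i - v i) (c := 0) hQ
      (fun i hi => by
        rw [hu.2 i hi, hv.2 i hi, ← Finset.sum_sub_distrib]
        simp only [mul_sub]
        exact le_rfl)
      (fun i hi => by rw [hu.1 i hi, hv.1 i hi, sub_self]) i
    linarith
  exact funext fun i => le_antisymm (key hu hv i) (key hv hu i)

/-- The Poisson equation with boundary values on `T` is solvable. -/
theorem MeetsClosed.exists_poisson {Q : ι → ι → ℝ} {T : Finset ι} (hQ : IsStochastic Q)
    (hT : MeetsClosed Q T) (b : ι → ℝ) :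
    ∃ u : ι → ℝ, (∀ i ∈ T, u i = b i) ∧ ∀ i, i ∉ T → u i = b i + ∑ j, Q i j * u j := by
  classical
  let F : (ι → ℝ) →ₗ[ℝ] (ι → ℝ) :=
    { toFun := fun u i => if i ∈ T then u i else u i - ∑ j, Q i j * u j
      map_add' := fun u v => by
        ext i
        by_cases hi : i ∈ T
        · simp [hi]
        · simp [hi, mul_add, Finset.sum_add_distrib]; ring
      map_smul' := fun c u => by
        ext i
        by_cases hi : i ∈ T
        · simp [hi]
        · simp [hi, mul_sub, Finset.mul_sum, mul_left_comm] }
  have hF : ∀ u i, F u i = if i ∈ T then u i else u i - ∑ j, Q i j * u j := fun _ _ => rfl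
  -- Uniqueness for the homogeneous problem is injectivity of `F`; in finite dimension this gives
  -- surjectivity.
  have hinj : Function.Injective F := by
    rw [← LinearMap.ker_eq_bot, LinearMap.ker_eq_bot']
    intro u hu
    refine IsHitting.unique hQ hT (b := 0) ⟨fun i hi => ?_, fun i hi => ?_⟩
      ⟨fun i _ => rfl, fun i _ => by simp⟩
    · simpa [hF, hi] using congrFun hu i
    · have := congrFun hu i
      simp only [hF, hi, if_false, Pi.zero_apply] at this
      linarith
  obtain ⟨u, hu⟩ := LinearMap.injective_iff_surjective.1 hinj b
  refine ⟨u, fun i hi => ?_, fun i hi => ?_⟩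
  · simpa [hF, hi] using congrFun hu i
  · have := congrFun hu i
    simp only [hF, hi, if_false] at this
    linarith

theorem MeetsClosed.exists_isHitting {Q : ι → ι → ℝ} {T : Finset ι} (hQ : IsStochastic Q)
    (hT : MeetsClosed Q T) (b : ι → ℝ) : ∃ u, IsHitting Q T b u := by
  classical
  obtain ⟨u, h1, h2⟩ := hT.exists_poisson hQ fun i => if i ∈ T then b i else 0
  refine ⟨u, fun i hi => ?_, fun i hi => ?_⟩
  · simpa [hi] using h1 i hi
  · simpa [hi] using h2 i hi

theorem IsHitting.mem_Icc {Q : ι → ι → ℝ} {T : Finset ι} (hQ : IsStochastic Q)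
    (hT : MeetsClosed Q T) {b u : ι → ℝ} (hu : IsHitting Q T b u) {c d : ℝ}
    (hb : ∀ i ∈ T, b i ∈ Set.Icc c d) (i : ι) : u i ∈ Set.Icc c d :=
  ⟨hT.le_of_superharmonic hQ (fun i hi => (hu.2 i hi).ge)
      (fun i hi => (hu.1 i hi).symm ▸ (hb i hi).1) i,
    hT.le_of_subharmonic hQ (fun i hi => (hu.2 i hi).le)
      (fun i hi => (hu.1 i hi).symm ▸ (hb i hi).2) i⟩

/-- Replacing one row of the chain by a row whose likelihood ratio lies in `[lo, hi]` changes the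
odds of a hitting probability by a factor of at most `hi / lo`. -/
theorem IsHitting.odds_le_of_row {Q Q' : ι → ι → ℝ} {T : Finset ι} {k : ι} (hk : k ∉ T)
    (hQ : IsStochastic Q) (hQ' : IsStochastic Q') (hT : MeetsClosed Q T) (hT' : MeetsClosed Q' T)
    (hrow : ∀ i, i ∉ T → i ≠ k → Q' i = Q i) {lo hi : ℝ} (hlo : 0 ≤ lo) (hhi : 0 ≤ hi)
    (hl : ∀ j, lo * Q k j ≤ Q' k j) (hh : ∀ j, Q' k j ≤ hi * Q k j)
    {b u u' : ι → ℝ} (hb : ∀ i ∈ T, b i ∈ Set.Icc (0 : ℝ) 1) (hu : IsHitting Q T b u)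
    (hu' : IsHitting Q' T b u') {g : ι → ℝ} (hg : ∀ i, 0 ≤ g i) :
    lo * ((∑ i, g i * u' i) * ∑ i, g i * (1 - u i))
      ≤ hi * ((∑ i, g i * u i) * ∑ i, g i * (1 - u' i)) := by
  classical
  -- Making `k` a target isolates the row being changed: `α` is the expected reward collected on `T`
  -- before any visit to `k`, and `c` is the probability of reaching `k` first. Neither depends on
  -- row `k`.
  have hTk : MeetsClosed Q (insert k T) := hT.mono (Finset.subset_insert k T)
  obtain ⟨α, hα⟩ := hTk.exists_isHitting hQ fun i => if i = k then 0 else b i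
  obtain ⟨c, hc⟩ := hTk.exists_isHitting hQ fun i => if i = k then 1 else 0
  have hne : ∀ i ∈ T, i ≠ k := fun i hi h => hk (h ▸ hi)
  have hαk : α k = 0 := by simpa using hα.1 k (Finset.mem_insert_self k T)
  have hck : c k = 1 := by simpa using hc.1 k (Finset.mem_insert_self k T)
  have hαT : ∀ i ∈ T, α i = b i := fun i hi => by
    simpa [hne i hi] using hα.1 i (Finset.mem_insert_of_mem hi)
  have hcT : ∀ i ∈ T, c i = 0 := fun i hi => by
    simpa [hne i hi] using hc.1 i (Finset.mem_insert_of_mem hi)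
  have hoff : ∀ i, i ∉ T → i ≠ k → i ∉ insert k T := fun i hi hik => by simp [hi, hik]
  have hα0 : ∀ i, 0 ≤ α i := fun i => (hα.mem_Icc hQ hTk (c := 0) (d := 1) (fun i hi => by
    rcases Finset.mem_insert.1 hi with rfl | hi
    · simp
    · simpa [hne i hi] using hb i hi) i).1
  have hc0 : ∀ i, 0 ≤ c i := fun i => (hc.mem_Icc hQ hTk (c := 0) (d := 1) (fun i hi => by
    by_cases h : i = k <;> simp [h]) i).1
  have hβ0 : ∀ i, 0 ≤ 1 - α i - c i := fun i =>
    hTk.le_of_superharmonic (z := fun i => 1 - α i - c i) hQ (fun i hi => by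
      rw [hα.2 i hi, hc.2 i hi]
      simp_rw [mul_sub, Finset.sum_sub_distrib, mul_one, hQ.sum_eq]
      exact le_rfl) (fun i hi => by
      rcases Finset.mem_insert.1 hi with rfl | hi
      · simp [hαk, hck]
      · simpa [hαT i hi, hcT i hi] using (hb i hi).2) i
  -- the decomposition at the first visit of `k`
  have dec : ∀ {Q₁ : ι → ι → ℝ} {w : ι → ℝ}, (∀ i, i ∉ T → i ≠ k → Q₁ i = Q i) →
      IsHitting Q₁ T b w → ∀ i, w i = α i + w k * c i := by
    intro Q₁ w h1 hw
    refine congrFun (IsHitting.unique hQ hTk (b := fun i => if i = k then w k else b i)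
      ⟨fun i hi => ?_, fun i hi => ?_⟩ ⟨fun i hi => ?_, fun i hi => ?_⟩)
    · rcases Finset.mem_insert.1 hi with rfl | hi
      · simp
      · simpa [hne i hi] using hw.1 i hi
    · rw [Finset.mem_insert, not_or] at hi
      rw [← h1 i hi.2 hi.1]
      exact hw.2 i hi.2
    · rcases Finset.mem_insert.1 hi with rfl | hi
      · simp [hαk, hck]
      · simp [hne i hi, hαT i hi, hcT i hi]
    · dsimp only
      rw [hα.2 i hi, hc.2 i hi, Finset.mul_sum, ← Finset.sum_add_distrib]
      exact Finset.sum_congr rfl fun j _ => by ring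
  -- Renewal at `k`: the bracket is the probability of not returning to `k`. Were it not positive,
  -- `c` would be subharmonic off `T` and vanish on `T`, contradicting `c k = 1`.
  have row : ∀ {Q₁ : ι → ι → ℝ} {w : ι → ℝ}, IsStochastic Q₁ → MeetsClosed Q₁ T →
      (∀ i, i ∉ T → i ≠ k → Q₁ i = Q i) → IsHitting Q₁ T b w →
      0 < ∑ j, Q₁ k j * α j + ∑ j, Q₁ k j * (1 - α j - c j) ∧
      w k * (∑ j, Q₁ k j * α j + ∑ j, Q₁ k j * (1 - α j - c j)) = ∑ j, Q₁ k j * α j := by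
    intro Q₁ w hs hm h1 hw
    have hsum : ∑ j, Q₁ k j * α j + ∑ j, Q₁ k j * (1 - α j - c j) = 1 - ∑ j, Q₁ k j * c j := by
      simp_rw [mul_sub, Finset.sum_sub_distrib, mul_one, hs.sum_eq]
      ring
    constructor
    · by_contra! hle
      have h3 := hm.le_of_subharmonic hs (z := c) (c := 0) (fun i hi => by
        by_cases hik : i = k
        · subst hik; linarith
        · rw [h1 i hi hik]; exact (hc.2 i (hoff i hi hik)).le) (fun i hi => (hcT i hi).le) k
      linarith
    · have h2 := hw.2 k hk
      have h3 : ∑ j, Q₁ k j * w j = ∑ j, Q₁ k j * α j + w k * ∑ j, Q₁ k j * c j := by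
        rw [Finset.mul_sum, ← Finset.sum_add_distrib]
        exact Finset.sum_congr rfl fun j _ => by rw [dec h1 hw j]; ring
      rw [hsum, mul_sub, mul_one]
      linarith
  have tot : ∀ {Q₁ : ι → ι → ℝ} {w : ι → ℝ}, (∀ i, i ∉ T → i ≠ k → Q₁ i = Q i) →
      IsHitting Q₁ T b w → ∑ i, g i * w i = ∑ i, g i * α i + w k * ∑ i, g i * c i ∧
      ∑ i, g i * (1 - w i) = ∑ i, g i * (1 - α i - c i) + (1 - w k) * ∑ i, g i * c i := by
    intro Q₁ w h1 hw
    constructor <;> rw [Finset.mul_sum, ← Finset.sum_add_distrib] <;>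
      exact Finset.sum_congr rfl fun j _ => by rw [dec h1 hw j]; ring
  obtain ⟨hD, hud⟩ := row hQ hT (fun _ _ _ => rfl) hu
  obtain ⟨hD', hud'⟩ := row hQ' hT' hrow hu'
  obtain ⟨e1, e2⟩ := tot (fun _ _ _ => rfl) hu
  obtain ⟨e3, e4⟩ := tot hrow hu'
  have bl : ∀ x : ι → ℝ, (∀ i, 0 ≤ x i) → lo * ∑ j, Q k j * x j ≤ ∑ j, Q' k j * x j := by
    intro x hx
    rw [Finset.mul_sum]
    exact Finset.sum_le_sum fun j _ => by
      rw [← mul_assoc]; exact mul_le_mul_of_nonneg_right (hl j) (hx j)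
  have bh : ∀ x : ι → ℝ, (∀ i, 0 ≤ x i) → ∑ j, Q' k j * x j ≤ hi * ∑ j, Q k j * x j := by
    intro x hx
    rw [Finset.mul_sum]
    exact Finset.sum_le_sum fun j _ => by
      rw [← mul_assoc]; exact mul_le_mul_of_nonneg_right (hh j) (hx j)
  have hgn : ∀ x : ι → ℝ, (∀ i, 0 ≤ x i) → 0 ≤ ∑ i, g i * x i := fun x hx =>
    Finset.sum_nonneg fun i _ => mul_nonneg (hg i) (hx i)
  have hqn : ∀ x : ι → ℝ, (∀ i, 0 ≤ x i) → 0 ≤ ∑ i, Q k i * x i := fun x hx =>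
    Finset.sum_nonneg fun i _ => mul_nonneg (hQ.nonneg k i) (hx i)
  have hA := hgn α hα0
  have hB := hgn _ hβ0
  have hC := hgn c hc0
  have pa := hqn α hα0
  have pb := hqn _ hβ0
  have la := bl α hα0
  have ha := bh α hα0
  have lb := bl _ hβ0
  have hb' := bh _ hβ0
  rw [e1, e2, e3, e4]
  generalize ∑ i, g i * α i = A at *
  generalize ∑ i, g i * (1 - α i - c i) = B at *
  generalize ∑ i, g i * c i = C at *
  generalize ∑ j, Q k j * α j = a at *
  generalize ∑ j, Q k j * (1 - α j - c j) = β at *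
  generalize ∑ j, Q' k j * α j = a' at *
  generalize ∑ j, Q' k j * (1 - α j - c j) = β' at *
  -- After clearing `a + β`, both sides of the odds are linear in `(a, β)` with nonnegative
  -- coefficients. Hence the numerator gains at most `hi` and the denominator retains at least `lo`,
  -- so one row costs a single factor `hi / lo`.
  have hN : (A + u k * C) * (a + β) = A * (a + β) + C * a := by
    linear_combination C * hud
  have hM : (B + (1 - u k) * C) * (a + β) = B * (a + β) + C * β := by linear_combination -C * hud
  have hN' : (A + u' k * C) * (a' + β') = A * (a' + β') + C * a' := by
    linear_combination C * hud'
  have hM' : (B + (1 - u' k) * C) * (a' + β') = B * (a' + β') + C * β' := by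
    linear_combination -C * hud'
  have i1 : A * (a' + β') + C * a' ≤ hi * (A * (a + β) + C * a) := by
    have := mul_le_mul_of_nonneg_left (add_le_add ha hb') hA
    have := mul_le_mul_of_nonneg_left ha hC
    linarith
  have i2 : lo * (B * (a + β) + C * β) ≤ B * (a' + β') + C * β' := by
    have := mul_le_mul_of_nonneg_left (add_le_add la lb) hB
    have := mul_le_mul_of_nonneg_left lb hC
    linarith
  have n1 : 0 ≤ lo * (B * (a + β) + C * β) := by positivity
  have n2 : 0 ≤ hi * (A * (a + β) + C * a) := by positivity
  have fin := mul_le_mul i1 i2 n1 n2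
  rw [← hN, ← hM, ← hN', ← hM'] at fin
  refine le_of_mul_le_mul_right ?_ (mul_pos hD hD')
  linarith

/-- Two chains whose likelihood ratios lie in `[lo, hi]` have hitting probabilities whose odds
differ by a factor of at most `(hi / lo) ^ k`, with `k` the number of states outside the target. -/
theorem IsHitting.odds_le {Q Q' : ι → ι → ℝ} {T : Finset ι} (hQ : IsStochastic Q)
    (hQ' : IsStochastic Q') (hT : MeetsClosed Q T) {lo hi : ℝ} (hlo : 0 < lo)
    (hhi : 0 ≤ hi) (hl : ∀ i j, lo * Q i j ≤ Q' i j) (hh : ∀ i j, Q' i j ≤ hi * Q i j)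
    {b u u' : ι → ℝ} (hb : ∀ i ∈ T, b i ∈ Set.Icc (0 : ℝ) 1) (hu : IsHitting Q T b u)
    (hu' : IsHitting Q' T b u') {g : ι → ℝ} (hg : g ∈ stdSimplex ℝ ι) {n : ℕ}
    (hn : Fintype.card ι = T.card + n) :
    lo ^ n * ((∑ i, g i * u' i) * (1 - ∑ i, g i * u i))
      ≤ hi ^ n * ((∑ i, g i * u i) * (1 - ∑ i, g i * u' i)) := by
  classical
  -- The hybrid chain uses the rows of `Q'` on `D` and those of `Q` elsewhere; `D` grows by one
  -- state at a time.
  let M : Finset ι → ι → ι → ℝ := fun D i => if i ∈ D then Q' i else Q i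
  have hMs : ∀ D, IsStochastic (M D) := fun D =>
    ⟨fun i j => by
        by_cases h : i ∈ D
        · simpa [M, h] using hQ'.nonneg i j
        · simpa [M, h] using hQ.nonneg i j,
      fun i => by
        by_cases h : i ∈ D
        · simpa [M, h] using hQ'.sum_eq i
        · simpa [M, h] using hQ.sum_eq i⟩
  have hpos : ∀ i j, Q i j ≠ 0 → Q' i j ≠ 0 := fun i j h => by
    have h1 : 0 < Q i j := lt_of_le_of_ne (hQ.nonneg i j) h.symm
    exact ((mul_pos hlo h1).trans_le (hl i j)).ne'
  have hMm : ∀ D, MeetsClosed (M D) T := fun D => hT.of_support fun i _ j hij => by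
    by_cases h : i ∈ D
    · simpa [M, h] using hpos i j hij
    · simpa [M, h] using hij
  have hg1 : ∀ x : ι → ℝ, ∑ i, g i * (1 - x i) = 1 - ∑ i, g i * x i := fun x => by
    simp_rw [mul_sub, Finset.sum_sub_distrib, mul_one, hg.2]
  have key : ∀ D : Finset ι, Disjoint D T → ∀ w, IsHitting (M D) T b w →
      lo ^ D.card * ((∑ i, g i * w i) * (1 - ∑ i, g i * u i))
        ≤ hi ^ D.card * ((∑ i, g i * u i) * (1 - ∑ i, g i * w i)) := by
    intro D
    induction D using Finset.induction_on with
    | empty =>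
      intro _ w hw
      have : w = u := hw.unique (hMs _) (hMm _) (by simpa [M] using hu)
      simp [this]
    | insert k D hkD ih =>
      intro hd w' hw'
      rw [Finset.disjoint_insert_left] at hd
      obtain ⟨w, hw⟩ := (hMm D).exists_isHitting (hMs D) b
      have h1 := ih hd.2 w hw
      have h2 := IsHitting.odds_le_of_row hd.1 (hMs D) (hMs (insert k D)) (hMm _) (hMm _)
        (fun i _ hik => by simp [M, hik]) hlo.le hhi
        (fun j => by simpa [M, hkD] using hl k j) (fun j => by simpa [M, hkD] using hh k j)
        hb hw hw' hg.1
      rw [hg1, hg1] at h2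
      rw [Finset.card_insert_of_notMem hkD]
      have bd : ∀ {D : Finset ι} {w : ι → ℝ}, IsHitting (M D) T b w →
          0 ≤ ∑ i, g i * w i ∧ 0 ≤ 1 - ∑ i, g i * w i := fun {D w} hw => by
        have hm := fun i => hw.mem_Icc (hMs D) (hMm D) hb i
        refine ⟨Finset.sum_nonneg fun i _ => mul_nonneg (hg.1 i) (hm i).1, ?_⟩
        rw [← hg1]
        exact Finset.sum_nonneg fun i _ => mul_nonneg (hg.1 i) (sub_nonneg.2 (hm i).2)
      obtain ⟨hX, hY⟩ := bd hw
      obtain ⟨hX', hY'⟩ := bd hw'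
      obtain ⟨hX0, hY0⟩ := bd (D := ∅) (w := u) (by simpa [M] using hu)
      generalize ∑ i, g i * w i = X at *
      generalize ∑ i, g i * w' i = X' at *
      generalize ∑ i, g i * u i = X0 at *
      have hloD : 0 < lo ^ D.card := pow_pos hlo _
      have hhiD : 0 ≤ hi ^ D.card := pow_nonneg hhi _
      -- The two bounds are multiplied and `X * (1 - X)` is cancelled. In the degenerate cases, `X =
      -- 0` forces `X' = 0` and `X = 1` forces `X0 = 1`.
      rcases hX.eq_or_lt with hX | hX
      · have : X' = 0 := by
          rw [← hX] at h2
          refine le_antisymm ?_ hX'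
          by_contra! h
          have := mul_pos hlo h
          simp at h2
          linarith
        rw [this]
        have : 0 ≤ hi ^ (D.card + 1) * X0 := mul_nonneg (pow_nonneg hhi _) hX0
        simpa using this
      rcases hY.eq_or_lt with hY | hY
      · have : 1 - X0 = 0 := by
          have hX1 : X = 1 := by linarith
          rw [hX1] at h1
          refine le_antisymm ?_ hY0
          by_contra! h
          have := mul_pos hloD h
          simp at h1
          linarith
        rw [this]
        have : 0 ≤ hi ^ (D.card + 1) * (X0 * (1 - X')) :=
          mul_nonneg (pow_nonneg hhi _) (mul_nonneg hX0 hY')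
        simpa using this
      · have h3 := mul_le_mul h1 h2 (mul_nonneg hlo.le (mul_nonneg hX' hY.le))
          (mul_nonneg hhiD (mul_nonneg hX0 hY.le))
        refine le_of_mul_le_mul_right ?_ (mul_pos hX hY)
        rw [pow_succ, pow_succ]
        linarith
  have h := key Tᶜ disjoint_compl_left u' ⟨hu'.1, fun i hi => by simpa [M, hi] using hu'.2 i hi⟩
  have hcard : (Tᶜ).card = n := by rw [Finset.card_compl]; omega
  rwa [hcard] at h

end Chains

/-! ### Payoffs as hitting values and the sender's stopping problem -/

section Payoffs

variable {S : Type u} {m : ℕ}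

open Classical in
/-- Stop exactly in the memory states of `T`. -/
noncomputable def stopOn (T : Finset (Fin m)) : SenderStrategy m where
  stopProb i _ := if i ∈ T then 1 else 0
  stopProb_mem i _ := by split_ifs <;> simp

theorem endProb_stopOn_mem (P : Protocol m S) {T : Finset (Fin m)} (θ : Nature) {i : Fin m}
    (hi : i ∈ T) : endProb P (stopOn T) θ i = 1 := by
  simp [endProb, stopOn, hi]

theorem endProb_stopOn_notMem (P : Protocol m S) {T : Finset (Fin m)} (θ : Nature) {i : Fin m}
    (hT : ∀ i, P.IsAbsorbing i → i ∈ T) (hi : i ∉ T) : endProb P (stopOn T) θ i = 0 := by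
  have : ¬ P.IsAbsorbing i := fun h => hi (hT i h)
  simp [endProb, stopOn, hi, this]

variable [Fintype S]

theorem isStochastic_transProb (E : SignalStructure S) (P : Protocol m S) (θ : Nature) :
    IsStochastic (transProb E P θ) :=
  ⟨transProb_nonneg E P θ, sum_transProb E P θ⟩

/-- By full support, a transition is possible iff some signal can trigger it, whatever the state of
nature. A stopping set that meets all closed classes in one state thus does so in the other. -/
theorem transProb_ne_zero_iff (E : SignalStructure S) (P : Protocol m S) (θ θ' : Nature)
    (i j : Fin m) : transProb E P θ i j ≠ 0 ↔ transProb E P θ' i j ≠ 0 := by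
  have key : ∀ θ, transProb E P θ i j = 0 ↔ ∀ s, P.f i s j = 0 := fun θ => by
    unfold transProb
    rw [Finset.sum_eq_zero_iff_of_nonneg fun s _ =>
      mul_nonneg (E.prob_pos θ s).le ((P.f_mem i s).1 j)]
    simp [(E.prob_pos θ _).ne']
  rw [not_iff_not, key, key]

theorem transProb_absorbing (E : SignalStructure S) {P : Protocol m S} (θ : Nature) {i : Fin m}
    (hi : P.IsAbsorbing i) (j : Fin m) : transProb E P θ i j = if j = i then 1 else 0 := by
  have h : ∀ s, P.f i s j = if j = i then 1 else 0 := fun s => by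
    split_ifs with hj
    · rw [hj, hi s]
    · have h1 := Finset.add_sum_erase Finset.univ (P.f i s) (Finset.mem_univ i)
      rw [(P.f_mem i s).2, hi s] at h1
      have h2 : ∑ j ∈ Finset.univ.erase i, P.f i s j = 0 := by linarith
      exact (Finset.sum_eq_zero_iff_of_nonneg fun j _ => (P.f_mem i s).1 j).1 h2 j
        (by simp [hj])
  unfold transProb
  simp_rw [h, ← Finset.sum_mul, E.sum_prob, one_mul]

/-- The expected value at the start of the `t`-th period satisfies a telescoping identity. -/
theorem sum_alive_succ_mul (E : SignalStructure S) (P : Protocol m S) (σ : SenderStrategy m)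
    (θ : Nature) (t : ℕ) (u : Fin m → ℝ) :
    ∑ j, alive E P σ θ (t + 1) j * u j
      = ∑ i, alive E P σ θ t i * ((1 - endProb P σ θ i) * ∑ j, transProb E P θ i j * u j) := by
  simp only [alive, Finset.sum_mul, Finset.mul_sum]
  rw [Finset.sum_comm]
  exact Finset.sum_congr rfl fun i _ => Finset.sum_congr rfl fun j _ => by ring

theorem hasSum_endsIn_mul (E : SignalStructure S) (P : Protocol m S) (σ : SenderStrategy m)
    (θ : Nature) (b : Fin m → ℝ) :
    HasSum (fun t => ∑ i, alive E P σ θ t i * endProb P σ θ i * b i)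
      (∑ i, endsIn E P σ θ i * b i) :=
  hasSum_sum fun i _ => (summable_alive_mul_endProb E P σ θ i).hasSum.mul_right (b i)

/-- Supermartingale property: the reward collected so far plus the value of the mass still alive
does not increase. -/
theorem sum_range_add_le (E : SignalStructure S) (P : Protocol m S) (σ : SenderStrategy m)
    (θ : Nature) {b u : Fin m → ℝ}
    (hu : ∀ i, endProb P σ θ i * b i
      + (1 - endProb P σ θ i) * ∑ j, transProb E P θ i j * u j ≤ u i) (n : ℕ) :
    ∑ t ∈ Finset.range n, ∑ i, alive E P σ θ t i * endProb P σ θ i * b i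
      + ∑ i, alive E P σ θ n i * u i ≤ ∑ i, P.g i * u i := by
  induction n with
  | zero => simp [alive]
  | succ n ih =>
    rw [Finset.sum_range_succ, add_assoc, sum_alive_succ_mul]
    refine le_trans (add_le_add le_rfl ?_) ih
    rw [← Finset.sum_add_distrib]
    refine Finset.sum_le_sum fun i _ => ?_
    have := mul_le_mul_of_nonneg_left (hu i) (alive_nonneg E P σ θ n i)
    linarith

/-- A nonnegative superharmonic function bounds the expected final reward. -/
theorem sum_endsIn_mul_le (E : SignalStructure S) (P : Protocol m S) (σ : SenderStrategy m)
    (θ : Nature) {b u : Fin m → ℝ} (h0 : ∀ i, 0 ≤ u i)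
    (hu : ∀ i, endProb P σ θ i * b i
      + (1 - endProb P σ θ i) * ∑ j, transProb E P θ i j * u j ≤ u i) :
    ∑ i, endsIn E P σ θ i * b i ≤ ∑ i, P.g i * u i := by
  refine le_of_tendsto (hasSum_endsIn_mul E P σ θ b).tendsto_sum_nat
    (Eventually.of_forall fun n => ?_)
  have h1 := sum_range_add_le E P σ θ hu n
  have h2 : 0 ≤ ∑ i, alive E P σ θ n i * u i :=
    Finset.sum_nonneg fun i _ => mul_nonneg (alive_nonneg E P σ θ n i) (h0 i)
  linarith

/-- If the game ends on `T` and `T` meets every closed class, then the game ends almost surely. -/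
theorem tendsto_alive_zero (E : SignalStructure S) (P : Protocol m S) (σ : SenderStrategy m)
    (θ : Nature) {T : Finset (Fin m)} (hT : MeetsClosed (transProb E P θ) T)
    (h1 : ∀ i ∈ T, endProb P σ θ i = 1) (h0 : ∀ i, i ∉ T → endProb P σ θ i = 0) (i : Fin m) :
    Tendsto (fun t => alive E P σ θ t i) atTop (𝓝 0) := by
  classical
  have hQ := isStochastic_transProb E P θ
  -- `w` is the expected number of periods spent outside `T`. Its finiteness makes the surviving
  -- mass summable over time, so this mass tends to 0.
  obtain ⟨w, hw1, hw2⟩ := hT.exists_poisson hQ fun i => if i ∈ T then 0 else 1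
  have hw0 : ∀ i, 0 ≤ w i := fun i => hT.le_of_superharmonic hQ
    (fun i hi => by rw [hw2 i hi]; simp [hi]) (fun i hi => by rw [hw1 i hi]; simp [hi]) i
  have hsum : ∀ n, ∑ t ∈ Finset.range n, ∑ i, alive E P σ θ t i * (1 - endProb P σ θ i)
      + ∑ i, alive E P σ θ n i * w i = ∑ i, P.g i * w i := by
    intro n
    induction n with
    | zero => simp [alive]
    | succ n ih =>
      rw [Finset.sum_range_succ, add_assoc, sum_alive_succ_mul, ← ih, ← Finset.sum_add_distrib]
      congr 1
      refine Finset.sum_congr rfl fun i _ => ?_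
      by_cases hi : i ∈ T
      · simp [h1 i hi, hw1 i hi, hi]
      · rw [h0 i hi, hw2 i hi]; simp [hi]; ring
  have hnn : ∀ t i, 0 ≤ alive E P σ θ t i * (1 - endProb P σ θ i) := fun t i =>
    mul_nonneg (alive_nonneg E P σ θ t i) (sub_nonneg.2 (endProb_mem P σ θ i).2)
  have hs : Summable fun t => ∑ i, alive E P σ θ t i * (1 - endProb P σ θ i) := by
    refine summable_of_sum_range_le (c := ∑ i, P.g i * w i)
      (fun t => Finset.sum_nonneg fun i _ => hnn t i) fun n => ?_
    have : 0 ≤ ∑ i, alive E P σ θ n i * w i :=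
      Finset.sum_nonneg fun i _ => mul_nonneg (alive_nonneg E P σ θ n i) (hw0 i)
    linarith [hsum n]
  rw [← tendsto_add_atTop_iff_nat 1]
  refine squeeze_zero (fun t => alive_nonneg E P σ θ (t + 1) i) (fun t => ?_)
    hs.tendsto_atTop_zero
  have h := sum_alive_succ_mul E P σ θ t fun _ => 1
  simp only [mul_one, sum_transProb] at h
  rw [← h]
  exact Finset.single_le_sum (fun j _ => alive_nonneg E P σ θ (t + 1) j) (Finset.mem_univ i)

/-- If the game ends on `T` and `T` meets every closed class, then the expected final reward is
the solution of the hitting problem. -/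
theorem sum_endsIn_mul_eq (E : SignalStructure S) (P : Protocol m S) (σ : SenderStrategy m)
    (θ : Nature) {T : Finset (Fin m)} (hT : MeetsClosed (transProb E P θ) T)
    (h1 : ∀ i ∈ T, endProb P σ θ i = 1) (h0 : ∀ i, i ∉ T → endProb P σ θ i = 0)
    {b u : Fin m → ℝ} (hu : IsHitting (transProb E P θ) T b u) :
    ∑ i, endsIn E P σ θ i * b i = ∑ i, P.g i * u i := by
  have hsum : ∀ n, ∑ t ∈ Finset.range n, ∑ i, alive E P σ θ t i * endProb P σ θ i * b i
      + ∑ i, alive E P σ θ n i * u i = ∑ i, P.g i * u i := by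
    intro n
    induction n with
    | zero => simp [alive]
    | succ n ih =>
      rw [Finset.sum_range_succ, add_assoc, sum_alive_succ_mul, ← ih, ← Finset.sum_add_distrib]
      congr 1
      refine Finset.sum_congr rfl fun i _ => ?_
      by_cases hi : i ∈ T
      · simp [h1 i hi, hu.1 i hi]
      · rw [h0 i hi, hu.2 i hi]; simp
  have hlim : Tendsto (fun n => ∑ i, alive E P σ θ n i * u i) atTop (𝓝 0) := by
    have := tendsto_finsetSum Finset.univ fun i _ =>
      (tendsto_alive_zero E P σ θ hT h1 h0 i).mul_const (u i)
    simpa using this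
  have h2 := (hasSum_endsIn_mul E P σ θ b).tendsto_sum_nat.add hlim
  simp_rw [hsum, add_zero] at h2
  exact (tendsto_nhds_unique h2 tendsto_const_nhds)

theorem endsIn_nonneg (E : SignalStructure S) (P : Protocol m S) (σ : SenderStrategy m)
    (θ : Nature) (i : Fin m) : 0 ≤ endsIn E P σ θ i :=
  tsum_nonneg fun t => mul_nonneg (alive_nonneg E P σ θ t i) (endProb_mem P σ θ i).1

theorem probHigh_nonneg (E : SignalStructure S) (P : Protocol m S) (σ : SenderStrategy m)
    (θ : Nature) : 0 ≤ probHigh E P σ θ :=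
  Finset.sum_nonneg fun i _ => mul_nonneg (endsIn_nonneg E P σ θ i) (P.a_mem i).1

theorem probLow_nonneg (E : SignalStructure S) (P : Protocol m S) (σ : SenderStrategy m)
    (θ : Nature) : 0 ≤ probLow E P σ θ :=
  Finset.sum_nonneg fun i _ => mul_nonneg (endsIn_nonneg E P σ θ i) (sub_nonneg.2 (P.a_mem i).2)

theorem probHigh_add_probLow_le (E : SignalStructure S) (P : Protocol m S) (σ : SenderStrategy m)
    (θ : Nature) : probHigh E P σ θ + probLow E P σ θ ≤ 1 := by
  have h := sum_endsIn_mul_le E P σ θ (b := fun _ => 1) (u := fun _ => 1) (fun _ => zero_le_one)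
    (fun i => by simp [sum_transProb])
  simp only [mul_one, P.g_mem.2] at h
  refine le_trans (le_of_eq ?_) h
  unfold probHigh probLow
  rw [← Finset.sum_add_distrib]
  exact Finset.sum_congr rfl fun i _ => by ring

theorem receiverPayoff_le_one {p : ℝ} (hp0 : 0 < p) (hp1 : p < 1) (E : SignalStructure S)
    (P : Protocol m S) (σ : SenderStrategy m) : receiverPayoff p E P σ ≤ 1 := by
  unfold receiverPayoff
  nlinarith [probHigh_add_probLow_le E P σ Nature.H, probHigh_add_probLow_le E P σ Nature.L,
    probHigh_nonneg E P σ Nature.L, probLow_nonneg E P σ Nature.H]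

/-- An absorbing state is a closed class by itself. Since the game ends there even without the
sender, this ensures that under `stopOn T` it ends exactly on `T`. -/
theorem MeetsClosed.absorbing_mem {E : SignalStructure S} {P : Protocol m S} {θ : Nature}
    {T : Finset (Fin m)} (hT : MeetsClosed (transProb E P θ) T) {i : Fin m}
    (hi : P.IsAbsorbing i) : i ∈ T := by
  obtain ⟨j, hj, hjT⟩ := hT {i} ⟨i, by simp⟩ fun k hk j hkj => by
    rw [Finset.mem_singleton] at hk ⊢
    subst hk
    by_contra hne
    exact hkj (by rw [transProb_absorbing E θ hi, if_neg hne])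
  rwa [Finset.mem_singleton.1 hj] at hjT

theorem probHigh_stopOn (E : SignalStructure S) (P : Protocol m S) (θ : Nature)
    {T : Finset (Fin m)} (hT : MeetsClosed (transProb E P θ) T) {u : Fin m → ℝ}
    (hu : IsHitting (transProb E P θ) T P.a u) :
    probHigh E P (stopOn T) θ = ∑ i, P.g i * u i :=
  sum_endsIn_mul_eq E P _ θ hT (fun _ hi => endProb_stopOn_mem P θ hi)
    (fun _ hi => endProb_stopOn_notMem P θ (fun _ => hT.absorbing_mem) hi) hu

theorem probLow_stopOn (E : SignalStructure S) (P : Protocol m S) (θ : Nature)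
    {T : Finset (Fin m)} (hT : MeetsClosed (transProb E P θ) T) {u : Fin m → ℝ}
    (hu : IsHitting (transProb E P θ) T P.a u) :
    probLow E P (stopOn T) θ = 1 - ∑ i, P.g i * u i := by
  have h := sum_endsIn_mul_eq E P _ θ hT (fun _ hi => endProb_stopOn_mem P θ hi)
    (fun _ hi => endProb_stopOn_notMem P θ (fun _ => hT.absorbing_mem) hi)
    (b := fun i => 1 - P.a i) (u := fun i => 1 - u i)
    ⟨fun i hi => by simp only [hu.1 i hi], fun i hi => by
      dsimp only
      rw [hu.2 i hi]; simp_rw [mul_sub, Finset.sum_sub_distrib, mul_one, sum_transProb]⟩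
  refine h.trans ?_
  simp_rw [mul_sub, Finset.sum_sub_distrib, mul_one, P.g_mem.2]

/-- The value function of the sender's stopping problem: it dominates every strategy, and stopping
where it equals the immediate reward reaches it. -/
theorem exists_stopping_value (E : SignalStructure S) (P : Protocol m S) (θ : Nature) :
    ∃ (T : Finset (Fin m)) (u : Fin m → ℝ), MeetsClosed (transProb E P θ) T ∧
      IsHitting (transProb E P θ) T P.a u ∧
      ∀ σ, probHigh E P σ θ ≤ ∑ i, P.g i * u i := by
  classical
  -- Value iteration must start at the immediate reward `P.a`: the constant 1 is also a fixed point
  -- of `B`, but need not be attainable by stopping.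
  let B : (Fin m → ℝ) → Fin m → ℝ := fun h i => max (P.a i) (∑ j, transProb E P θ i j * h j)
  let h : ℕ → Fin m → ℝ := fun n => B^[n] P.a
  have hs : ∀ n, h (n + 1) = B (h n) := fun n => Function.iterate_succ_apply' B n P.a
  have hmono' : ∀ n i, h n i ≤ h (n + 1) i := by
    intro n
    induction n with
    | zero => intro i; rw [hs]; exact le_max_left _ _
    | succ n ih =>
      intro i
      rw [hs (n + 1)]
      nth_rw 1 [hs n]
      exact max_le_max le_rfl (Finset.sum_le_sum fun j _ =>
        mul_le_mul_of_nonneg_left (ih j) (transProb_nonneg E P θ i j))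
  have hbd : ∀ (R : Finset (Fin m)), (∀ i ∈ R, ∀ j, transProb E P θ i j ≠ 0 → j ∈ R) →
      ∀ c, (∀ i ∈ R, P.a i ≤ c) → ∀ n, ∀ i ∈ R, h n i ≤ c := by
    intro R hR c hc n
    induction n with
    | zero => exact hc
    | succ n ih =>
      intro i hi
      rw [hs]
      refine max_le (hc i hi) ?_
      calc ∑ j, transProb E P θ i j * h n j ≤ ∑ j, transProb E P θ i j * c :=
            Finset.sum_le_sum fun j _ => by
              by_cases hj : transProb E P θ i j = 0
              · simp [hj]
              · exact mul_le_mul_of_nonneg_left (ih j (hR i hi j hj))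
                  (transProb_nonneg E P θ i j)
        _ = c := by rw [← Finset.sum_mul, sum_transProb, one_mul]
  have hbd1 : ∀ n i, h n i ≤ 1 := fun n i =>
    hbd Finset.univ (fun _ _ _ _ => Finset.mem_univ _) 1 (fun i _ => (P.a_mem i).2) n i
      (Finset.mem_univ i)
  have hlim : ∀ i, Tendsto (fun n => h n i) atTop (𝓝 (⨆ n, h n i)) := fun i =>
    tendsto_atTop_ciSup (monotone_nat_of_le_succ fun n => hmono' n i)
      ⟨1, by rintro _ ⟨n, rfl⟩; exact hbd1 n i⟩
  set u : Fin m → ℝ := fun i => ⨆ n, h n i with hu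
  have hfix : ∀ i, u i = max (P.a i) (∑ j, transProb E P θ i j * u j) := fun i => by
    have h1 := (tendsto_add_atTop_iff_nat 1).2 (hlim i)
    simp_rw [hs] at h1
    refine tendsto_nhds_unique h1 ?_
    exact tendsto_const_nhds.max (tendsto_finsetSum _ fun j _ => (hlim j).const_mul _)
  have hua : ∀ i, P.a i ≤ u i := fun i => (hfix i).symm ▸ le_max_left _ _
  have huQ : ∀ i, ∑ j, transProb E P θ i j * u j ≤ u i := fun i => by
    conv_rhs => rw [hfix i]
    exact le_max_right _ _
  refine ⟨Finset.univ.filter fun i => u i = P.a i, u, ?_, ⟨?_, ?_⟩, fun σ => ?_⟩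
  · intro R hR hRc
    -- Within a closed class no iterate exceeds the best reward of the class, so stopping is optimal
    -- where that reward is attained.
    obtain ⟨k, hk, hmax⟩ := Finset.exists_max_image R P.a hR
    refine ⟨k, hk, ?_⟩
    simp only [Finset.mem_filter, Finset.mem_univ, true_and]
    exact le_antisymm (le_of_tendsto' (hlim k) fun n => hbd R hRc _ hmax n k hk) (hua k)
  · intro i hi
    simpa using hi
  · intro i hi
    simp only [Finset.mem_filter, Finset.mem_univ, true_and] at hi
    rcases max_choice (P.a i) (∑ j, transProb E P θ i j * u j) with h1 | h1
    · exact absurd ((hfix i).trans h1) hi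
    · exact (hfix i).trans h1
  · refine sum_endsIn_mul_le E P σ θ (fun i => (P.a_mem i).1.trans (hua i)) fun i => ?_
    have he := endProb_mem P σ θ i
    have h1 := mul_le_mul_of_nonneg_left (hua i) he.1
    have h2 := mul_le_mul_of_nonneg_left (huQ i) (sub_nonneg.2 he.2)
    linarith

theorem probHigh_congr (E : SignalStructure S) (P : Protocol m S) {σ τ : SenderStrategy m}
    {θ : Nature} (h : ∀ i, σ.stopProb i θ = τ.stopProb i θ) :
    probHigh E P σ θ = probHigh E P τ θ := by
  have he : ∀ i, endProb P σ θ i = endProb P τ θ i := fun i => by simp only [endProb, h i]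
  have ha : ∀ t i, alive E P σ θ t i = alive E P τ θ t i := by
    intro t
    induction t with
    | zero => intro i; rfl
    | succ t ih => intro i; simp only [alive, ih, he]
  simp only [probHigh, endsIn, ha, he]

/-- A best response maximizes the probability of the action `H` in the state of nature `L`. -/
theorem probHigh_le_of_mem_bestResponses {p : ℝ} (hp1 : p < 1) {E : SignalStructure S}
    {P : Protocol m S} {σ : SenderStrategy m} (hσ : σ ∈ bestResponses p E P)
    (τ : SenderStrategy m) : probHigh E P τ Nature.L ≤ probHigh E P σ Nature.L := by
  -- Splicing `σ` in state H with `τ` in state L changes only the L term of the sender's payoff.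
  let ρ : SenderStrategy m :=
    { stopProb := fun i θ => match θ with
        | .H => σ.stopProb i .H
        | .L => τ.stopProb i .L
      stopProb_mem := fun i θ => by cases θ <;> exact SenderStrategy.stopProb_mem _ _ _ }
  have h := hσ ρ
  unfold senderPayoff at h
  rw [probHigh_congr E P (σ := ρ) (τ := σ) (θ := .H) fun _ => rfl,
    probHigh_congr E P (σ := ρ) (τ := τ) (θ := .L) fun _ => rfl] at h
  have h1 : 0 < 1 - p := by linarith
  exact le_of_mul_le_mul_left (by linarith) h1

end Payoffs

/-! ### The informativeness index and the odds bound for best responses -/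

section Gamma

variable {S : Type u} [Fintype S]

theorem SignalStructure.nonempty (E : SignalStructure S) : Nonempty S := by
  by_contra h
  rw [not_nonempty_iff] at h
  have := E.sum_prob Nature.H
  rw [Finset.univ_eq_empty, Finset.sum_empty] at this
  exact zero_ne_one this

/-- The extreme likelihood ratios are attained, by two different signals. -/
theorem SignalStructure.exists_extreme (E : SignalStructure S) :
    ∃ h l : S, E.gamma = (E.prob .H h / E.prob .L h) / (E.prob .H l / E.prob .L l) ∧
      E.prob .H l / E.prob .L l < E.prob .H h / E.prob .L h ∧
      ∀ s, E.prob .H s / E.prob .L s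
        ∈ Set.Icc (E.prob .H l / E.prob .L l) (E.prob .H h / E.prob .L h) := by
  have := E.nonempty
  obtain ⟨h, hh⟩ := exists_eq_ciSup_of_finite (f := fun s => E.prob .H s / E.prob .L s)
  obtain ⟨l, hl⟩ := exists_eq_ciInf_of_finite (f := fun s => E.prob .H s / E.prob .L s)
  have hmem : ∀ s, E.prob .H s / E.prob .L s
        ∈ Set.Icc (E.prob .H l / E.prob .L l) (E.prob .H h / E.prob .L h) := fun s =>
    ⟨hl.le.trans (ciInf_le (Set.finite_range _).bddBelow s),
      (le_ciSup (Set.finite_range _).bddAbove s).trans hh.ge⟩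
  refine ⟨h, l, by rw [SignalStructure.gamma, ← hh, ← hl], ?_, hmem⟩
  -- If the extremes coincided, the two distributions would be proportional, hence equal because
  -- both sum to 1.
  by_contra! hle
  have hc : ∀ s, E.prob .H s = (E.prob .H h / E.prob .L h) * E.prob .L s := fun s => by
    rw [← div_eq_iff (E.prob_pos .L s).ne']
    exact le_antisymm (hmem s).2 (hle.trans (hmem s).1)
  have h1 := E.sum_prob .H
  rw [Finset.sum_congr rfl fun s _ => hc s, ← Finset.mul_sum, E.sum_prob, mul_one] at h1
  exact E.prob_ne (funext fun s => by rw [hc s, h1, one_mul])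

theorem SignalStructure.one_lt_gamma (E : SignalStructure S) : 1 < E.gamma := by
  obtain ⟨h, l, hg, hlt, -⟩ := E.exists_extreme
  rw [hg, one_lt_div (div_pos (E.prob_pos _ _) (E.prob_pos _ _))]
  exact hlt

/-- The sender's optimal probabilities of the action `H` in the two states of nature have odds
that differ by a factor of at most `gamma ^ (m - 2)`. -/
theorem odds_le_of_mem_bestResponses {p : ℝ} (hp1 : p < 1) {m : ℕ} (hm : 2 ≤ m)
    {E : SignalStructure S} {P : Protocol m S} {σ : SenderStrategy m}
    (hσ : σ ∈ bestResponses p E P) :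
    probHigh E P σ .H * (1 - probHigh E P σ .L)
      ≤ E.gamma ^ (m - 2) * (probHigh E P σ .L * (1 - probHigh E P σ .H)) := by
  obtain ⟨T, u, hT, hu, hmax⟩ := exists_stopping_value E P .H
  have hTL : MeetsClosed (transProb E P .L) T :=
    hT.of_support fun i _ j => (transProb_ne_zero_iff E P .H .L i j).1
  obtain ⟨v, hv⟩ := hTL.exists_isHitting (isStochastic_transProb E P .L) P.a
  have hx := hmax σ
  -- In state L the sender does at least as well as by imitating the rule that is optimal in state
  -- H.
  have hy := probHigh_le_of_mem_bestResponses hp1 hσ (stopOn T)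
  rw [probHigh_stopOn E P .L hTL hv] at hy
  have hG : 0 < E.gamma := one_pos.trans E.one_lt_gamma
  have hx0 := probHigh_nonneg E P σ .H
  have hy1 : probHigh E P σ .L ≤ 1 := by
    linarith [probHigh_add_probLow_le E P σ .L, probLow_nonneg E P σ .L]
  have hx1 : probHigh E P σ .H ≤ 1 := by
    linarith [probHigh_add_probLow_le E P σ .H, probLow_nonneg E P σ .H]
  have hvn : 0 ≤ ∑ i, P.g i * v i := Finset.sum_nonneg fun i _ => mul_nonneg (P.g_mem.1 i)
    (hv.mem_Icc (isStochastic_transProb E P .L) hTL (fun i _ => P.a_mem i) i).1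
  have key : (∑ i, P.g i * u i) * (1 - ∑ i, P.g i * v i)
      ≤ E.gamma ^ (m - 2) * ((∑ i, P.g i * v i) * (1 - ∑ i, P.g i * u i)) := by
    have hne : T.Nonempty := by
      obtain ⟨i, -, hi⟩ := hT Finset.univ ⟨⟨0, by omega⟩, Finset.mem_univ _⟩
        fun _ _ _ _ => Finset.mem_univ _
      exact ⟨i, hi⟩
    rcases Nat.lt_or_ge 1 T.card with hc | hc
    · obtain ⟨h, l, hg, -, hmem⟩ := E.exists_extreme
      have hlo : 0 < E.prob .H l / E.prob .L l := div_pos (E.prob_pos _ _) (E.prob_pos _ _)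
      have hhi : 0 < E.prob .H h / E.prob .L h := div_pos (E.prob_pos _ _) (E.prob_pos _ _)
      have hcard : T.card ≤ m := by simpa using Finset.card_le_univ T
      have h1 := IsHitting.odds_le (isStochastic_transProb E P .L) (isStochastic_transProb E P .H)
        hTL hlo hhi.le
        (fun i j => by
          unfold transProb
          rw [Finset.mul_sum]
          refine Finset.sum_le_sum fun s _ => ?_
          rw [← mul_assoc]
          exact mul_le_mul_of_nonneg_right ((le_div_iff₀ (E.prob_pos .L s)).1 (hmem s).1)
            ((P.f_mem i s).1 j))
        (fun i j => by
          unfold transProb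
          rw [Finset.mul_sum]
          refine Finset.sum_le_sum fun s _ => ?_
          rw [← mul_assoc]
          exact mul_le_mul_of_nonneg_right ((div_le_iff₀ (E.prob_pos .L s)).1 (hmem s).2)
            ((P.f_mem i s).1 j))
        (fun i _ => P.a_mem i) hv hu P.g_mem (n := m - T.card) (by simp; omega)
      have hun : 0 ≤ 1 - ∑ i, P.g i * u i := by
        have := Finset.sum_le_sum fun i (_ : i ∈ Finset.univ) => mul_le_of_le_one_right
          (P.g_mem.1 i)
          (hu.mem_Icc (isStochastic_transProb E P .H) hT (fun i _ => P.a_mem i) i).2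
        rw [P.g_mem.2] at this
        linarith
      have h2 : E.gamma ^ (m - T.card) ≤ E.gamma ^ (m - 2) :=
        pow_le_pow_right₀ E.one_lt_gamma.le (by omega)
      refine le_trans ?_ (mul_le_mul_of_nonneg_right h2 (mul_nonneg hvn hun))
      rw [hg, div_pow, div_mul_eq_mul_div, le_div_iff₀ (pow_pos hlo _)]
      linarith
    · obtain ⟨k, rfl⟩ := Finset.card_eq_one.1 (le_antisymm hc hne.card_pos)
      have hconst : ∀ {θ : Nature} {w : Fin m → ℝ}, MeetsClosed (transProb E P θ) {k} →
          IsHitting (transProb E P θ) {k} P.a w → ∑ i, P.g i * w i = P.a k := by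
        intro θ w hm' hw
        have : w = fun _ => P.a k := hw.unique (isStochastic_transProb E P θ) hm'
          ⟨fun i hi => by rw [Finset.mem_singleton.1 hi],
            fun i _ => by rw [← Finset.sum_mul, sum_transProb, one_mul]⟩
        rw [this, ← Finset.sum_mul, P.g_mem.2, one_mul]
      rw [hconst hT hu, hconst hTL hv]
      have ha := P.a_mem k
      have : 1 ≤ E.gamma ^ (m - 2) := one_le_pow₀ E.one_lt_gamma.le
      exact le_mul_of_one_le_left (mul_nonneg ha.1 (sub_nonneg.2 ha.2)) this
  have hGn : 0 < E.gamma ^ (m - 2) := pow_pos hG _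
  generalize E.gamma ^ (m - 2) = G at *
  calc _ ≤ (∑ i, P.g i * u i) * (1 - ∑ i, P.g i * v i) :=
        mul_le_mul hx (by linarith) (by linarith) (hx0.trans hx)
    _ ≤ _ := key
    _ ≤ _ := mul_le_mul_of_nonneg_left (by
        by_cases hun : 0 ≤ 1 - ∑ i, P.g i * u i
        · exact mul_le_mul hy (by linarith) hun (hvn.trans hy)
        · have h3 := mul_nonneg hvn (neg_nonneg.2 (not_le.1 hun).le)
          have h4 := mul_nonneg (hvn.trans hy) (sub_nonneg.2 hx1)
          linarith) hGn.le

end Gamma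

/-! ### Maximization on the odds frontier -/

section Frontier

/-- The receiver's payoff at the point of the odds frontier `x (1 - y) = G y (1 - x)` at which the
action `H` has probability `x` in the state of nature `H` and `y` in the state of nature `L`. -/
noncomputable def frontierPayoff (p G x : ℝ) : ℝ :=
  p * x + (1 - p) * (G * (1 - x) / (x + G * (1 - x)))

/-- The largest payoff on the odds frontier. -/
noncomputable def frontierValue (p G : ℝ) : ℝ := sSup (frontierPayoff p G '' Set.Icc 0 1)

theorem frontier_denom_pos {G x : ℝ} (hG : 0 < G) (hx : x ∈ Set.Icc (0 : ℝ) 1) :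
    0 < x + G * (1 - x) := by
  rcases hx.1.eq_or_lt with h | h
  · rw [← h]; simpa using hG
  · have := mul_nonneg hG.le (sub_nonneg.2 hx.2)
    linarith

theorem frontierPayoff_zero {p G : ℝ} (hG : 0 < G) : frontierPayoff p G 0 = 1 - p := by
  simp [frontierPayoff, hG.ne']

theorem frontierPayoff_one (p G : ℝ) : frontierPayoff p G 1 = p := by
  simp [frontierPayoff]

theorem continuousOn_frontierPayoff (p : ℝ) {G : ℝ} (hG : 0 < G) :
    ContinuousOn (frontierPayoff p G) (Set.Icc 0 1) := by
  unfold frontierPayoff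
  refine (by fun_prop : ContinuousOn (fun x : ℝ => p * x) _).add
    (continuousOn_const.mul (ContinuousOn.div (by fun_prop) (by fun_prop) fun x hx =>
      (frontier_denom_pos hG hx).ne'))

theorem isGreatest_frontierValue (p : ℝ) {G : ℝ} (hG : 0 < G) :
    IsGreatest (frontierPayoff p G '' Set.Icc 0 1) (frontierValue p G) :=
  (isCompact_Icc.image_of_continuousOn (continuousOn_frontierPayoff p hG)).isGreatest_sSup
    ((Set.nonempty_Icc.2 zero_le_one).image _)

theorem frontierPayoff_le (p : ℝ) {G x : ℝ} (hG : 0 < G) (hx : x ∈ Set.Icc (0 : ℝ) 1) :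
    frontierPayoff p G x ≤ frontierValue p G :=
  (isGreatest_frontierValue p hG).2 ⟨x, hx, rfl⟩

theorem max_le_frontierValue (p : ℝ) {G : ℝ} (hG : 0 < G) :
    max p (1 - p) ≤ frontierValue p G := by
  have h1 := frontierPayoff_le p hG (x := 1) (by simp)
  have h0 := frontierPayoff_le p hG (x := 0) (by simp)
  rw [frontierPayoff_one] at h1
  rw [frontierPayoff_zero hG] at h0
  exact max_le h1 h0

/-- Below the odds frontier the payoff is at most the frontier value. -/
theorem le_frontierValue {p G x y : ℝ} (hp1 : p < 1) (hG : 0 < G) (hx : x ∈ Set.Icc (0 : ℝ) 1)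
    (hxy : x * (1 - y) ≤ G * (y * (1 - x))) :
    p * x + (1 - p) * (1 - y) ≤ frontierValue p G := by
  refine le_trans (add_le_add le_rfl (mul_le_mul_of_nonneg_left ?_ (by linarith)))
    (frontierPayoff_le p hG hx)
  rw [le_div_iff₀ (frontier_denom_pos hG hx)]
  linarith

/-- The last factor is affine in `x` and equals `(1 - p) G - p` at `x = 1`, so its sign there
compares `G` with `p / (1 - p)`. The companion identity at `x = 0` yields the other term of `kappa`.
-/
theorem frontierPayoff_sub_p {p G x : ℝ} (hG : 0 < G) (hx : x ∈ Set.Icc (0 : ℝ) 1) :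
    (frontierPayoff p G x - p) * (x + G * (1 - x))
      = (1 - x) * ((1 - p) * G - p * (x + G * (1 - x))) := by
  have := (frontier_denom_pos hG hx).ne'
  unfold frontierPayoff
  field_simp
  ring

theorem frontierPayoff_sub_one_sub_p {p G x : ℝ} (hG : 0 < G) (hx : x ∈ Set.Icc (0 : ℝ) 1) :
    (frontierPayoff p G x - (1 - p)) * (x + G * (1 - x))
      = x * (p * (x + G * (1 - x)) - (1 - p)) := by
  have := (frontier_denom_pos hG hx).ne'
  unfold frontierPayoff
  field_simp
  ring

theorem one_le_kappa {p : ℝ} (hp0 : 0 < p) (hp1 : p < 1) : 1 ≤ kappa p := by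
  have h : 0 < 1 - p := by linarith
  rcases le_total (1 / 2) p with hp | hp
  · exact le_max_of_le_left ((one_le_div h).2 (by linarith))
  · exact le_max_of_le_right ((one_le_div hp0).2 (by linarith))

/-- If the odds spread does not outweigh the prior, acting on the prior is optimal. -/
theorem frontierValue_of_le_kappa {p G : ℝ} (hp0 : 0 < p) (hp1 : p < 1) (hG : 1 ≤ G)
    (hk : G ≤ kappa p) : frontierValue p G = max p (1 - p) := by
  have hG0 : 0 < G := one_pos.trans_le hG
  have h1p : 0 < 1 - p := by linarith
  refine le_antisymm ?_ (max_le_frontierValue p hG0)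
  obtain ⟨x, hx, hxv⟩ := (isGreatest_frontierValue p hG0).1
  rw [← hxv]
  have hd := frontier_denom_pos hG0 hx
  have hd1 : 0 ≤ (G - 1) * (1 - x) := mul_nonneg (by linarith) (by linarith [hx.2])
  have hd2 : 0 ≤ (G - 1) * x := mul_nonneg (by linarith) hx.1
  rcases le_max_iff.1 hk with hk | hk
  · rw [le_div_iff₀ h1p] at hk
    refine le_max_of_le_left (sub_nonpos.1 (nonpos_of_mul_nonpos_left ?_ hd))
    rw [frontierPayoff_sub_p hG0 hx]
    refine mul_nonpos_of_nonneg_of_nonpos (by linarith [hx.2]) ?_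
    have := mul_nonneg hp0.le hd1
    linarith
  · rw [le_div_iff₀ hp0] at hk
    refine le_max_of_le_right (sub_nonpos.1 (nonpos_of_mul_nonpos_left ?_ hd))
    rw [frontierPayoff_sub_one_sub_p hG0 hx]
    refine mul_nonpos_of_nonneg_of_nonpos hx.1 ?_
    have := mul_nonneg hp0.le hd2
    linarith

/-- If the odds spread outweighs the prior, the optimum is interior. -/
theorem exists_interior_frontierValue {p G : ℝ} (hp0 : 0 < p) (hp1 : p < 1) (hk : kappa p < G) :
    ∃ x ∈ Set.Ioo (0 : ℝ) 1, frontierPayoff p G x = frontierValue p G := by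
  have hG1 : 1 < G := (one_le_kappa hp0 hp1).trans_lt hk
  have hG0 : 0 < G := one_pos.trans hG1
  have h1p : 0 < 1 - p := by linarith
  obtain ⟨x, hx, hxv⟩ := (isGreatest_frontierValue p hG0).1
  obtain ⟨k1, k2⟩ := max_lt_iff.1 hk
  rw [div_lt_iff₀ h1p] at k1
  rw [div_lt_iff₀ hp0] at k2
  refine ⟨x, ⟨lt_of_le_of_ne hx.1 ?_, lt_of_le_of_ne hx.2 ?_⟩, hxv⟩
  · rintro rfl
    rw [frontierPayoff_zero hG0] at hxv
    -- Below this bound the affine factor stays positive, so moving from 0 to `y` improves on `1 -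
    -- p`.
    obtain ⟨y, hy0, hy⟩ := exists_between
      (show (0 : ℝ) < min 1 ((G * p - (1 - p)) / (p * (G - 1))) from
        lt_min one_pos (div_pos (by linarith) (mul_pos hp0 (by linarith))))
    obtain ⟨hy1, hy2⟩ := lt_min_iff.1 hy
    rw [lt_div_iff₀ (mul_pos hp0 (by linarith))] at hy2
    have hym : y ∈ Set.Icc (0 : ℝ) 1 := ⟨hy0.le, hy1.le⟩
    have h := frontierPayoff_le p hG0 hym
    have e := frontierPayoff_sub_one_sub_p (p := p) hG0 hym
    have h2 : 0 < y * (p * (y + G * (1 - y)) - (1 - p)) := mul_pos hy0 (by linarith)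
    rw [← e] at h2
    have := pos_of_mul_pos_left h2 (frontier_denom_pos hG0 hym).le
    linarith
  · rintro rfl
    rw [frontierPayoff_one] at hxv
    obtain ⟨y, hy0, hy⟩ := exists_between
      (show (0 : ℝ) < min 1 ((G * (1 - p) - p) / (p * (G - 1))) from
        lt_min one_pos (div_pos (by linarith) (mul_pos hp0 (by linarith))))
    obtain ⟨hy1, hy2⟩ := lt_min_iff.1 hy
    rw [lt_div_iff₀ (mul_pos hp0 (by linarith))] at hy2
    have hym : 1 - y ∈ Set.Icc (0 : ℝ) 1 := ⟨by linarith, by linarith⟩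
    have h := frontierPayoff_le p hG0 hym
    have e := frontierPayoff_sub_p (p := p) hG0 hym
    have h2 : 0 < (1 - (1 - y)) * ((1 - p) * G - p * (1 - y + G * (1 - (1 - y)))) :=
      mul_pos (by linarith) (by linarith)
    rw [← e] at h2
    have := pos_of_mul_pos_left h2 (frontier_denom_pos hG0 hym).le
    linarith

/-- For fixed interior `x` the payoff is strictly increasing in `G`, whereas at 0 and 1 it does not
move. This is why an interior maximizer for `G` is needed. -/
theorem frontierValue_lt {p G G' : ℝ} (hp0 : 0 < p) (hp1 : p < 1) (hk : kappa p < G)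
    (hGG : G < G') : frontierValue p G < frontierValue p G' := by
  have hG0 : 0 < G := one_pos.trans_le ((one_le_kappa hp0 hp1).trans hk.le)
  obtain ⟨x, hx, hxv⟩ := exists_interior_frontierValue hp0 hp1 hk
  have hx' : x ∈ Set.Icc (0 : ℝ) 1 := Set.Ioo_subset_Icc_self hx
  rw [← hxv]
  refine lt_of_lt_of_le ?_ (frontierPayoff_le p (hG0.trans hGG) hx')
  unfold frontierPayoff
  have h1p : 0 < 1 - p := by linarith
  refine add_lt_add_right (mul_lt_mul_of_pos_left ?_ h1p) _
  rw [div_lt_div_iff₀ (frontier_denom_pos hG0 hx') (frontier_denom_pos (hG0.trans hGG) hx')]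
  have := mul_pos (mul_pos hx.1 (sub_pos.2 hx.2)) (sub_pos.2 hGG)
  linarith

theorem frontierValue_le_one {p G : ℝ} (hp0 : 0 < p) (hp1 : p < 1) (hG : 0 < G) :
    frontierValue p G ≤ 1 := by
  obtain ⟨x, hx, hxv⟩ := (isGreatest_frontierValue p hG).1
  rw [← hxv]
  have h1 : G * (1 - x) / (x + G * (1 - x)) ≤ 1 :=
    (div_le_one (frontier_denom_pos hG hx)).2 (by linarith [hx.1])
  have h2 := mul_le_mul_of_nonneg_left h1 (sub_nonneg.2 hp1.le)
  have h3 := mul_le_mul_of_nonneg_left hx.2 hp0.le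
  unfold frontierPayoff
  linarith

/-- The point `x = √G / (1 + √G)` equalizes the error probabilities in the two states, so the prior
drops out. -/
theorem one_sub_le_frontierValue (p : ℝ) {G : ℝ} (hG : 0 < G) :
    1 - 1 / (1 + √G) ≤ frontierValue p G := by
  have hs : 0 < √G := Real.sqrt_pos.2 hG
  have hx : √G / (1 + √G) ∈ Set.Icc (0 : ℝ) 1 :=
    ⟨by positivity, (div_le_one (by positivity)).2 (by linarith)⟩
  refine le_of_eq_of_le ?_ (frontierPayoff_le p hG hx)
  unfold frontierPayoff
  have hsq : G = √G ^ 2 := (Real.sq_sqrt hG.le).symm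
  generalize √G = s at *
  subst hsq
  have e1 : 1 - s / (1 + s) = 1 / (1 + s) := by field_simp; ring
  have e2 : s / (1 + s) + s ^ 2 * (1 / (1 + s)) = s := by field_simp
  rw [e1, e2]
  field_simp
  ring

theorem tendsto_frontierValue_atTop {p : ℝ} (hp0 : 0 < p) (hp1 : p < 1) :
    Tendsto (frontierValue p) atTop (𝓝 1) := by
  refine tendsto_of_tendsto_of_tendsto_of_le_of_le' (g := fun G => 1 - 1 / (1 + √G))
    (h := fun _ => (1 : ℝ)) ?_ tendsto_const_nhds ?_ ?_
  · have : Tendsto (fun G : ℝ => 1 / (1 + √G)) atTop (𝓝 0) := by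
      simp_rw [one_div]
      exact (tendsto_atTop_add_const_left _ _ Real.tendsto_sqrt_atTop).inv_tendsto_atTop
    simpa using tendsto_const_nhds.sub this
  · filter_upwards [eventually_gt_atTop 0] with G hG using one_sub_le_frontierValue p hG
  · filter_upwards [eventually_gt_atTop 0] with G hG using frontierValue_le_one hp0 hp1 hG

/-- At fixed `x` the two fractions differ by `x (1 - x) (G - K)` over a product of denominators that
are at least 1. The resulting Lipschitz constant 1 allows `δ = ε` in the limit at `kappa`. -/
theorem frontierValue_sub_le {p K G : ℝ} (hp0 : 0 < p) (hp1 : p < 1) (hK : 1 ≤ K) (hKG : K ≤ G) :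
    frontierValue p G ≤ frontierValue p K + (G - K) := by
  have hK0 : 0 < K := one_pos.trans_le hK
  have hG0 : 0 < G := hK0.trans_le hKG
  obtain ⟨x, hx, hxv⟩ := (isGreatest_frontierValue p hG0).1
  rw [← hxv]
  have h1 := frontierPayoff_le p hK0 hx
  have dK := frontier_denom_pos hK0 hx
  have dG := frontier_denom_pos hG0 hx
  have key : G * (1 - x) / (x + G * (1 - x)) - K * (1 - x) / (x + K * (1 - x)) ≤ G - K := by
    rw [div_sub_div _ _ dG.ne' dK.ne', div_le_iff₀ (mul_pos dG dK)]
    have e1 : 1 ≤ x + K * (1 - x) := by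
      linarith [mul_nonneg (sub_nonneg.2 hK) (sub_nonneg.2 hx.2)]
    have e2 : 1 ≤ x + G * (1 - x) := by
      linarith [mul_nonneg (sub_nonneg.2 (hK.trans hKG)) (sub_nonneg.2 hx.2)]
    have e3 : 1 ≤ (x + G * (1 - x)) * (x + K * (1 - x)) := one_le_mul_of_one_le_of_one_le e2 e1
    have e4 : x * (1 - x) ≤ 1 := mul_le_one₀ hx.2 (by linarith [hx.2]) (by linarith [hx.1])
    have e5 := mul_le_mul_of_nonneg_left (e4.trans e3) (sub_nonneg.2 hKG)
    linarith
  have h2 := mul_le_of_le_one_left (sub_nonneg.2 hKG) (show 1 - p ≤ 1 by linarith)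
  have h3 := mul_le_mul_of_nonneg_left key (sub_nonneg.2 hp1.le)
  unfold frontierPayoff at *
  linarith

end Frontier

/-! ### The climbing protocol and the value of the receiver's problem -/

section Climb

variable {S : Type u} {n : ℕ}

open Classical in
/-- The protocol with absorbing states `0` and `Fin.last`, of which only the latter leads to the
action `H`. In between, the signal `h` moves the memory up with probability `μ`, and the signal
`l` moves it to `0` with probability `lam` and otherwise back to the initial state `1`. -/
noncomputable def climbProtocol (n : ℕ) (h l : S) {μ lam : ℝ} (hμ : μ ∈ Set.Icc (0 : ℝ) 1)
    (hlam : lam ∈ Set.Icc (0 : ℝ) 1) : Protocol (n + 2) S where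
  f i s :=
    if i = 0 ∨ i = Fin.last (n + 1) then Pi.single i 1
    else if s = h then μ • Pi.single (i + 1) 1 + (1 - μ) • Pi.single i 1
    else if s = l then lam • Pi.single 0 1 + (1 - lam) • Pi.single 1 1
    else Pi.single i 1
  f_mem i s := by
    split_ifs
    · exact single_mem_stdSimplex ℝ i
    · exact convex_stdSimplex ℝ _ (single_mem_stdSimplex ℝ _) (single_mem_stdSimplex ℝ _)
        hμ.1 (sub_nonneg.2 hμ.2) (by ring)
    · exact convex_stdSimplex ℝ _ (single_mem_stdSimplex ℝ _) (single_mem_stdSimplex ℝ _)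
        hlam.1 (sub_nonneg.2 hlam.2) (by ring)
    · exact single_mem_stdSimplex ℝ i
  g := Pi.single 1 1
  g_mem := single_mem_stdSimplex ℝ 1
  a i := if i = Fin.last (n + 1) then 1 else 0
  a_mem i := by split_ifs <;> simp

variable [Fintype S]

theorem sum_transProb_mul {m : ℕ} (E : SignalStructure S) (P : Protocol m S) (θ : Nature)
    (i : Fin m) (u : Fin m → ℝ) :
    ∑ j, transProb E P θ i j * u j = ∑ s, E.prob θ s * ∑ j, P.f i s j * u j := by
  simp only [transProb, Finset.sum_mul, Finset.mul_sum]
  rw [Finset.sum_comm]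
  exact Finset.sum_congr rfl fun i _ => Finset.sum_congr rfl fun j _ => by ring

theorem sum_climbProtocol_boundary (E : SignalStructure S) (θ : Nature) {h l : S} {μ lam : ℝ}
    (hμ : μ ∈ Set.Icc (0 : ℝ) 1) (hlam : lam ∈ Set.Icc (0 : ℝ) 1) {i : Fin (n + 2)}
    (hi : i = 0 ∨ i = Fin.last (n + 1)) (u : Fin (n + 2) → ℝ) :
    ∑ j, transProb E (climbProtocol n h l hμ hlam) θ i j * u j = u i := by
  rw [sum_transProb_mul]
  simp [climbProtocol, hi, Pi.single_apply, ← Finset.sum_mul, E.sum_prob]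

theorem sum_climbProtocol_interior (E : SignalStructure S) (θ : Nature) {h l : S} (hhl : h ≠ l)
    {μ lam : ℝ} (hμ : μ ∈ Set.Icc (0 : ℝ) 1) (hlam : lam ∈ Set.Icc (0 : ℝ) 1) {i : Fin (n + 2)}
    (hi : ¬ (i = 0 ∨ i = Fin.last (n + 1))) (u : Fin (n + 2) → ℝ) :
    ∑ j, transProb E (climbProtocol n h l hμ hlam) θ i j * u j
      = u i + E.prob θ h * μ * (u (i + 1) - u i)
        + E.prob θ l * (lam * u 0 + (1 - lam) * u 1 - u i) := by
  classical
  rw [sum_transProb_mul]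
  have hf : ∀ s, ∑ j, (climbProtocol n h l hμ hlam).f i s j * u j
      = u i + (if s = h then μ * (u (i + 1) - u i) else 0)
        + (if s = l then lam * u 0 + (1 - lam) * u 1 - u i else 0) := by
    intro s
    by_cases h1 : s = h
    · subst h1
      simp only [climbProtocol, hi, hhl, if_false, if_true, Pi.add_apply, Pi.smul_apply,
        smul_eq_mul, Pi.single_apply, add_mul, mul_ite, ite_mul, mul_one, mul_zero, zero_mul,
        Finset.sum_add_distrib, Finset.sum_ite_eq', Finset.mem_univ]
      ring
    · by_cases h2 : s = l
      · subst h2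
        simp only [climbProtocol, hi, h1, if_false, if_true, Pi.add_apply, Pi.smul_apply,
          smul_eq_mul, Pi.single_apply, add_mul, mul_ite, ite_mul, mul_one, mul_zero, zero_mul,
          Finset.sum_add_distrib, Finset.sum_ite_eq', Finset.mem_univ]
        ring
      · simp [climbProtocol, hi, h1, h2, Pi.single_apply]
  simp_rw [hf, mul_add, Finset.sum_add_distrib, mul_ite, mul_zero, Finset.sum_ite_eq',
    ← Finset.sum_mul, E.sum_prob]
  simp only [Finset.mem_univ, if_true]
  ring

theorem meetsClosed_climbProtocol (E : SignalStructure S) (θ : Nature) {h l : S} (hhl : h ≠ l)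
    {μ lam : ℝ} (hμ : μ ∈ Set.Icc (0 : ℝ) 1) (hlam : lam ∈ Set.Icc (0 : ℝ) 1) (h0 : 0 < lam) :
    MeetsClosed (transProb E (climbProtocol n h l hμ hlam) θ) {0, Fin.last (n + 1)} := by
  rintro R ⟨i, hi⟩ hR
  by_cases hb : i = 0 ∨ i = Fin.last (n + 1)
  · exact ⟨i, hi, by simpa using hb⟩
  · refine ⟨0, hR i hi 0 ?_, by simp⟩
    have h1 := sum_climbProtocol_interior E θ hhl hμ hlam hb (Pi.single 0 1)
    rw [not_or] at hb
    have h2 : i + 1 ≠ 0 := by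
      have hlt : i < Fin.last (n + 1) := lt_of_le_of_ne (Fin.le_last i) hb.2
      rw [Ne, Fin.ext_iff, Fin.val_add_one_of_lt hlt]
      simp
    simp [Pi.single_apply, hb.1, h2] at h1
    rw [h1]
    exact (mul_pos (E.prob_pos θ l) h0).ne'

/-- The probability that the climb ends at the top: `r` is the relative frequency of the signal
that moves up. -/
noncomputable def climbProb (n : ℕ) (μ lam r : ℝ) : ℝ :=
  (μ * r / (μ * r + 1)) ^ n / (lam + (μ * r / (μ * r + 1)) ^ n * (1 - lam))

/-- The sender lets the climb run to its end. -/
theorem climbProtocol_outcome (E : SignalStructure S) (θ : Nature) {h l : S}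
    (hhl : h ≠ l) {μ lam : ℝ} (hμ : μ ∈ Set.Icc (0 : ℝ) 1) (hμ0 : 0 < μ)
    (hlam : lam ∈ Set.Icc (0 : ℝ) 1) (hlam0 : 0 < lam) :
    probHigh E (climbProtocol n h l hμ hlam) (stopOn {0, Fin.last (n + 1)}) θ
        = climbProb n μ lam (E.prob θ h / E.prob θ l) ∧
      probLow E (climbProtocol n h l hμ hlam) (stopOn {0, Fin.last (n + 1)}) θ
        = 1 - climbProb n μ lam (E.prob θ h / E.prob θ l) ∧
      ∀ σ, probHigh E (climbProtocol n h l hμ hlam) σ θ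
        ≤ climbProb n μ lam (E.prob θ h / E.prob θ l) := by
  have hr : 0 < E.prob θ h / E.prob θ l := div_pos (E.prob_pos _ _) (E.prob_pos _ _)
  -- The fraction, later `q`, is the probability that an effective upward move occurs before the
  -- signal `l`.
  have hqe : μ * (E.prob θ h / E.prob θ l) / (μ * (E.prob θ h / E.prob θ l) + 1)
      * (E.prob θ h * μ + E.prob θ l) = E.prob θ h * μ := by
    have := E.prob_pos θ h
    have := E.prob_pos θ l
    field_simp
  unfold climbProb
  have hq0 : 0 < μ * (E.prob θ h / E.prob θ l) / (μ * (E.prob θ h / E.prob θ l) + 1) := by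
    positivity
  have hq1 : μ * (E.prob θ h / E.prob θ l) / (μ * (E.prob θ h / E.prob θ l) + 1) ≤ 1 :=
    (div_le_one (by positivity)).2 (by linarith)
  generalize μ * (E.prob θ h / E.prob θ l) / (μ * (E.prob θ h / E.prob θ l) + 1) = q at *
  set P := climbProtocol n h l hμ hlam with hP
  have hden : 0 < lam + q ^ n * (1 - lam) := by
    have := mul_nonneg (pow_pos hq0 n).le (sub_nonneg.2 hlam.2)
    linarith
  -- `U` solves `U = q ^ n + (1 - q ^ n) * (1 - lam) * U`: either `n` moves succeed in a row, or the
  -- signal `l` intervenes and the climb restarts with probability `1 - lam`. Below, `w` is the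
  -- value right after `l`.
  set U := q ^ n / (lam + q ^ n * (1 - lam)) with hU
  have hUe : U * (lam + q ^ n * (1 - lam)) = q ^ n := div_mul_cancel₀ _ hden.ne'
  have hU0 : 0 ≤ U := div_nonneg (pow_pos hq0 n).le hden.le
  have hU1 : U ≤ 1 := by
    rw [hU, div_le_one hden]
    have := mul_nonneg hlam.1 (sub_nonneg.2 (pow_le_one₀ hq0.le hq1 (n := n)))
    linarith
  set w := (1 - lam) * U with hw
  have hw0 : 0 ≤ w := mul_nonneg (sub_nonneg.2 hlam.2) hU0
  have hw1 : w ≤ 1 := mul_le_one₀ (by linarith) hU0 hU1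
  let u : Fin (n + 2) → ℝ := fun i => if i = 0 then 0 else w + q ^ (n + 1 - (i : ℕ)) * (1 - w)
  have hu0 : u 0 = 0 := by simp [u]
  have hune : ∀ i, i ≠ 0 → u i = w + q ^ (n + 1 - (i : ℕ)) * (1 - w) := fun i hi => by
    simp [u, hi]
  have hu1 : u 1 = U := by
    rw [hune 1 (by simp)]
    have : n + 1 - ((1 : Fin (n + 2)) : ℕ) = n := by simp
    rw [this, hw]
    linear_combination -hUe
  have hul : u (Fin.last (n + 1)) = 1 := by
    rw [hune _ (Fin.last_pos).ne']
    simp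
  have hunn : ∀ i, 0 ≤ u i := fun i => by
    by_cases hi : i = 0
    · rw [hi, hu0]
    · rw [hune i hi]
      have := mul_nonneg (pow_pos hq0 (n + 1 - (i : ℕ))).le (sub_nonneg.2 hw1)
      linarith
  have hharm : ∀ i, ∑ j, transProb E P θ i j * u j = u i := by
    intro i
    by_cases hi : i = 0 ∨ i = Fin.last (n + 1)
    · exact sum_climbProtocol_boundary E θ hμ hlam hi u
    · rw [hP, sum_climbProtocol_interior E θ hhl hμ hlam hi u, hu0, hu1]
      rw [not_or] at hi
      have hlt : i < Fin.last (n + 1) := lt_of_le_of_ne (Fin.le_last i) hi.2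
      have hv := Fin.val_add_one_of_lt hlt
      have hne : i + 1 ≠ 0 := by
        rw [Ne, Fin.ext_iff, hv]
        simp
      rw [hune i hi.1, hune (i + 1) hne, hv]
      have hlt' : (i : ℕ) < n + 1 := hlt
      obtain ⟨e, he⟩ : ∃ e, n + 1 - (i : ℕ) = e + 1 := ⟨n - i, by omega⟩
      have he' : n + 1 - ((i : ℕ) + 1) = e := by omega
      rw [he, he', pow_succ, hw]
      linear_combination (-(q ^ e * (1 - (1 - lam) * U))) * hqe
  have hT := meetsClosed_climbProtocol (n := n) E θ hhl hμ hlam hlam0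
  have hlast : (Fin.last (n + 1) : Fin (n + 2)) ≠ 0 := (Fin.last_pos).ne'
  have hit : IsHitting (transProb E P θ) {0, Fin.last (n + 1)} P.a u := by
    refine ⟨fun i hi => ?_, fun i _ => (hharm i).symm⟩
    rcases Finset.mem_insert.1 hi with rfl | hi
    · simp [hu0, hP, climbProtocol, hlast.symm]
    · rw [Finset.mem_singleton.1 hi, hul]
      simp [hP, climbProtocol]
  have hg : ∑ i, P.g i * u i = U := by
    simp [hP, climbProtocol, Pi.single_apply, hu1]
  refine ⟨(probHigh_stopOn E P θ hT hit).trans hg, ?_, fun σ => ?_⟩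
  · rw [probLow_stopOn E P θ hT hit, hg]
  -- `u` is harmonic everywhere and dominates the reward, so stopping early never helps the sender.
  · rw [← hg]
    refine sum_endsIn_mul_le E P σ θ hunn fun i => ?_
    rw [hharm]
    have hau : P.a i ≤ u i := by
      by_cases hi : i = Fin.last (n + 1)
      · rw [hi, hul]
        exact (P.a_mem _).2
      · have : P.a i = 0 := by simp [hP, climbProtocol, hi]
        rw [this]
        exact hunn i
    have := mul_le_mul_of_nonneg_left hau (endProb_mem P σ θ i).1
    linarith

theorem receiverPayoff_le_receiverValue {p : ℝ} (hp0 : 0 < p) (hp1 : p < 1) {m : ℕ}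
    {E : SignalStructure S} {P : Protocol m S} {σ : SenderStrategy m}
    (hσ : σ ∈ bestResponses p E P) : receiverPayoff p E P σ ≤ receiverValue p E P :=
  le_ciSup (f := fun σ : bestResponses p E P => receiverPayoff p E P σ)
    ⟨1, by rintro _ ⟨τ, rfl⟩; exact receiverPayoff_le_one hp0 hp1 E P τ⟩ ⟨σ, hσ⟩

theorem receiverValue_le_optimalPayoff {p : ℝ} (hp0 : 0 < p) (hp1 : p < 1) {m : ℕ}
    (E : SignalStructure S) (P : Protocol m S) : receiverValue p E P ≤ optimalPayoff p E m :=
  le_ciSup (f := fun P : Protocol m S => receiverValue p E P)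
    ⟨1, by
      rintro _ ⟨P, rfl⟩
      exact Real.iSup_le (fun σ => receiverPayoff_le_one hp0 hp1 E P σ) zero_le_one⟩ P

theorem climbProtocol_le_optimalPayoff {p : ℝ} (hp0 : 0 < p) (hp1 : p < 1)
    (E : SignalStructure S) {h l : S} (hhl : h ≠ l) {μ lam : ℝ} (hμ : μ ∈ Set.Ioc (0 : ℝ) 1)
    (hlam : lam ∈ Set.Ioc (0 : ℝ) 1) :
    p * climbProb n μ lam (E.prob .H h / E.prob .H l)
        + (1 - p) * (1 - climbProb n μ lam (E.prob .L h / E.prob .L l))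
      ≤ optimalPayoff p E (n + 2) := by
  obtain ⟨h1, -, h2⟩ := climbProtocol_outcome E .H hhl (Set.Ioc_subset_Icc_self hμ) hμ.1
    (Set.Ioc_subset_Icc_self hlam) hlam.1
  obtain ⟨l1, l2, l3⟩ := climbProtocol_outcome E .L hhl (Set.Ioc_subset_Icc_self hμ) hμ.1
    (Set.Ioc_subset_Icc_self hlam) hlam.1
  refine le_trans ?_ ((receiverPayoff_le_receiverValue hp0 hp1
    (σ := stopOn {0, Fin.last (n + 1)}) fun τ => ?_).trans
    (receiverValue_le_optimalPayoff hp0 hp1 E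
      (climbProtocol n h l (Set.Ioc_subset_Icc_self hμ) (Set.Ioc_subset_Icc_self hlam))))
  · rw [receiverPayoff, h1, l2]
  · unfold senderPayoff
    rw [h1, l1]
    exact add_le_add (mul_le_mul_of_nonneg_left (h2 τ) hp0.le)
      (mul_le_mul_of_nonneg_left (l3 τ) (sub_nonneg.2 hp1.le))

/-- For small `μ` the chance of a full climb is about `(μ * r) ^ n`, of the same order as the
failure probability `C * μ ^ n`. The limiting odds are therefore `r ^ n / C`. -/
theorem tendsto_climbProb (n : ℕ) {C r : ℝ} (hC : 0 < C) (hr : 0 < r) (hn : 0 < n) :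
    Tendsto (fun μ => climbProb n μ (C * μ ^ n) r) (𝓝[>] 0) (𝓝 (r ^ n / (C + r ^ n))) := by
  have hlim : Tendsto (fun μ : ℝ => r ^ n
      / (C * (μ * r + 1) ^ n + r ^ n * (1 - C * μ ^ n))) (𝓝[>] 0) (𝓝 (r ^ n / (C + r ^ n))) := by
    have : ContinuousAt (fun μ : ℝ => r ^ n
        / (C * (μ * r + 1) ^ n + r ^ n * (1 - C * μ ^ n))) 0 := by
      refine ContinuousAt.div (by fun_prop) (by fun_prop) ?_
      have : 0 < C + r ^ n := by positivity
      simpa [hn.ne'] using this.ne'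
    have h2 := this.tendsto
    simp only [zero_mul, zero_add, one_pow, mul_one, ne_eq, hn.ne', not_false_eq_true, zero_pow,
      mul_zero, sub_zero] at h2
    exact h2.mono_left nhdsWithin_le_nhds
  refine hlim.congr' ?_
  filter_upwards [self_mem_nhdsWithin] with μ hμ
  have hμ0 : (0 : ℝ) < μ := hμ
  have e : (C * (μ * r + 1) ^ n + r ^ n * (1 - C * μ ^ n)) * (μ ^ n / (μ * r + 1) ^ n)
      = C * μ ^ n + (μ * r / (μ * r + 1)) ^ n * (1 - C * μ ^ n) := by
    have : 0 < μ * r + 1 := by positivity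
    rw [div_pow, mul_pow]
    field_simp
  have hk : μ ^ n / (μ * r + 1) ^ n ≠ 0 := by positivity
  rw [climbProb, ← e, ← mul_div_mul_right _ _ hk]
  congr 1
  rw [div_pow, mul_pow]
  ring

/-- Every interior point of the odds frontier is approached. -/
theorem frontierPayoff_le_optimalPayoff {p : ℝ} (hp0 : 0 < p) (hp1 : p < 1) (hn : 0 < n)
    (E : SignalStructure S) {x : ℝ} (hx : x ∈ Set.Ioo (0 : ℝ) 1) :
    frontierPayoff p (E.gamma ^ n) x ≤ optimalPayoff p E (n + 2) := by
  obtain ⟨h, l, hg, hlt, -⟩ := E.exists_extreme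
  have hhl : h ≠ l := fun e => by rw [e] at hlt; exact lt_irrefl _ hlt
  have h1 := E.prob_pos .H h
  have h2 := E.prob_pos .H l
  have h3 := E.prob_pos .L h
  have h4 := E.prob_pos .L l
  have hrH : 0 < E.prob .H h / E.prob .H l := div_pos h1 h2
  have hrL : 0 < E.prob .L h / E.prob .L l := div_pos h3 h4
  have hgr : E.prob .H h / E.prob .H l = E.gamma * (E.prob .L h / E.prob .L l) := by
    rw [hg]
    field_simp
  have hG : 0 < E.gamma := one_pos.trans E.one_lt_gamma
  have hx1 : 0 < 1 - x := sub_pos.2 hx.2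
  -- This value of `C` makes the limiting probability in state H equal to `x`; in state L the odds
  -- are then smaller by the factor `E.gamma ^ n`.
  have hC : 0 < (E.prob .H h / E.prob .H l) ^ n * ((1 - x) / x) :=
    mul_pos (pow_pos hrH n) (div_pos hx1 hx.1)
  have lim := ((tendsto_climbProb n hC hrH hn).const_mul p).add
    ((tendsto_const_nhds (x := (1 : ℝ)).sub (tendsto_climbProb n hC hrL hn)).const_mul (1 - p))
  have e : frontierPayoff p (E.gamma ^ n) x
      = p * ((E.prob .H h / E.prob .H l) ^ n / ((E.prob .H h / E.prob .H l) ^ n * ((1 - x) / x)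
          + (E.prob .H h / E.prob .H l) ^ n))
        + (1 - p) * (1 - (E.prob .L h / E.prob .L l) ^ n
          / ((E.prob .H h / E.prob .H l) ^ n * ((1 - x) / x)
            + (E.prob .L h / E.prob .L l) ^ n)) := by
    have hd := frontier_denom_pos (pow_pos hG n) (Set.Ioo_subset_Icc_self hx)
    have hrn := pow_pos hrL n
    have hx0 := hx.1
    rw [hgr, mul_pow]
    have hgn := pow_pos hG n
    unfold frontierPayoff
    generalize E.gamma ^ n = G at *
    generalize (E.prob .L h / E.prob .L l) ^ n = R at *
    have e1 : G * R / (G * R * ((1 - x) / x) + G * R) = x := by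
      field_simp
      ring
    have e2 : G * R * ((1 - x) / x) + R = R * (x + G * (1 - x)) / x := by
      field_simp
      ring
    rw [e1, e2]
    field_simp
    ring
  rw [e]
  refine le_of_tendsto lim ?_
  have hc : Tendsto (fun μ : ℝ => (E.prob .H h / E.prob .H l) ^ n * ((1 - x) / x) * μ ^ n)
      (𝓝[>] 0) (𝓝 0) := by
    have : ContinuousAt
        (fun μ : ℝ => (E.prob .H h / E.prob .H l) ^ n * ((1 - x) / x) * μ ^ n) 0 := by fun_prop
    have h5 := this.tendsto
    simp only [ne_eq, hn.ne', not_false_eq_true, zero_pow, mul_zero] at h5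
    exact h5.mono_left nhdsWithin_le_nhds
  filter_upwards [self_mem_nhdsWithin, hc.eventually_le_const one_pos,
    mem_nhdsWithin_of_mem_nhds (Iic_mem_nhds (show (0 : ℝ) < 1 from one_pos))] with μ m1 m2 m3
  exact climbProtocol_le_optimalPayoff hp0 hp1 E hhl ⟨m1, m3⟩
    ⟨mul_pos hC (pow_pos m1 n), m2⟩

/-- A protocol that never moves and takes the action `H` with probability `c`. -/
noncomputable def constProtocol (S : Type u) (n : ℕ) {c : ℝ} (hc : c ∈ Set.Icc (0 : ℝ) 1) :
    Protocol (n + 1) S where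
  f i _ := Pi.single i 1
  f_mem i _ := single_mem_stdSimplex ℝ i
  g := Pi.single 0 1
  g_mem := single_mem_stdSimplex ℝ 0
  a _ := c
  a_mem _ := hc

theorem receiverValue_constProtocol (p : ℝ) (E : SignalStructure S) (n : ℕ)
    {c : ℝ} (hc : c ∈ Set.Icc (0 : ℝ) 1) :
    receiverValue p E (constProtocol S n hc) = p * c + (1 - p) * (1 - c) := by
  have habs : ∀ i, (constProtocol S n hc).IsAbsorbing i := fun i s => by simp [constProtocol]
  have hT : ∀ θ, MeetsClosed (transProb E (constProtocol S n hc) θ) Finset.univ :=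
    fun θ R ⟨i, hi⟩ _ => ⟨i, hi, Finset.mem_univ i⟩
  have he : ∀ σ θ i, endProb (constProtocol S n hc) σ θ i = 1 := fun σ θ i => by
    simp [endProb, habs i]
  have hend : ∀ σ θ b, ∑ i, endsIn E (constProtocol S n hc) σ θ i * b = b := fun σ θ b => by
    rw [sum_endsIn_mul_eq E _ σ θ (hT θ) (fun i _ => he σ θ i)
      (fun i hi => absurd (Finset.mem_univ i) hi) (b := fun _ => b) (u := fun _ => b)
      ⟨fun _ _ => rfl, fun i hi => absurd (Finset.mem_univ i) hi⟩, ← Finset.sum_mul,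
      (constProtocol S n hc).g_mem.2, one_mul]
  have hH : ∀ σ θ, probHigh E (constProtocol S n hc) σ θ = c := fun σ θ => hend σ θ c
  have hL : ∀ σ θ, probLow E (constProtocol S n hc) σ θ = 1 - c := fun σ θ => hend σ θ (1 - c)
  have hmem : stopOn Finset.univ ∈ bestResponses p E (constProtocol S n hc) := fun τ => by
    simp [senderPayoff, hH]
  have : Nonempty (bestResponses p E (constProtocol S n hc)) := ⟨⟨_, hmem⟩⟩
  simp [receiverValue, receiverPayoff, hH, hL]

/-- The optimal payoff is the largest payoff on the odds frontier. -/
theorem optimalPayoff_eq_frontierValue {p : ℝ} (hp0 : 0 < p) (hp1 : p < 1)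
    (E : SignalStructure S) {m : ℕ} (hm : 2 ≤ m) :
    optimalPayoff p E m = frontierValue p (E.gamma ^ (m - 2)) := by
  obtain ⟨n, rfl⟩ := Nat.exists_eq_add_of_le' hm
  rw [Nat.add_sub_cancel]
  have hG : 0 < E.gamma ^ n := pow_pos (one_pos.trans E.one_lt_gamma) n
  have hmax : max p (1 - p) ≤ optimalPayoff p E (n + 2) := by
    refine max_le ?_ ?_
    · have h := receiverValue_le_optimalPayoff hp0 hp1 E
        (constProtocol S (n + 1) (c := 1) (by simp))
      rw [receiverValue_constProtocol] at h
      simpa using h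
    · have h := receiverValue_le_optimalPayoff hp0 hp1 E
        (constProtocol S (n + 1) (c := 0) (by simp))
      rw [receiverValue_constProtocol] at h
      simpa using h
  refine le_antisymm ?_ ?_
  · have h0 : 0 ≤ frontierValue p (E.gamma ^ n) :=
      (le_max_of_le_left hp0.le).trans (max_le_frontierValue p hG)
    -- Nonnegativity of the bound covers a protocol without best responses, whose supremum would be
    -- 0 by convention.
    refine Real.iSup_le (fun P => Real.iSup_le (fun σ => ?_) h0) h0
    have hodds := odds_le_of_mem_bestResponses hp1 hm σ.2
    rw [Nat.add_sub_cancel] at hodds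
    have hx0 := probHigh_nonneg E P σ .H
    have hx1 := probHigh_add_probLow_le E P σ .H
    have hx2 := probLow_nonneg E P σ .H
    have hy := probHigh_add_probLow_le E P σ .L
    refine le_trans (add_le_add le_rfl (mul_le_mul_of_nonneg_left ?_ (sub_nonneg.2 hp1.le)))
      (le_frontierValue hp1 hG ⟨hx0, by linarith⟩ hodds)
    linarith
  · obtain ⟨x, hx, hxv⟩ := (isGreatest_frontierValue p hG).1
    rw [← hxv]
    -- Constant protocols realize the endpoints of the frontier. They also settle `n = 0`, where `G
    -- = 1 ≤ kappa p`.
    rcases hx.1.eq_or_lt with h0 | h0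
    · rw [← h0, frontierPayoff_zero hG]
      exact (le_max_right _ _).trans hmax
    rcases hx.2.eq_or_lt with h1 | h1
    · rw [h1, frontierPayoff_one]
      exact (le_max_left _ _).trans hmax
    rcases n.eq_zero_or_pos with hn | hn
    · have h2 := frontierPayoff_le p hG hx
      rw [hn, pow_zero, frontierValue_of_le_kappa hp0 hp1 le_rfl (one_le_kappa hp0 hp1)] at h2
      rw [hn, pow_zero]
      subst hn
      exact h2.trans hmax
    · exact frontierPayoff_le_optimalPayoff hp0 hp1 hn E ⟨h0, h1⟩

end Climb

/-! ### Comparative statics and limits of the optimal payoff -/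

theorem mainTheorem5 (p : ℝ) (hp0 : 0 < p) (hp1 : p < 1) :
    -- the optimal payoff depends on the signal structure only through `gamma`
    (∀ (S : Type u) (S' : Type v) [Fintype S] [Fintype S']
        (E : SignalStructure S) (E' : SignalStructure S') (m : ℕ), 2 ≤ m →
        E.gamma = E'.gamma → optimalPayoff p E m = optimalPayoff p E' m) ∧
    -- (i) it is strictly increasing in `gamma` and in `m`
    (∀ (S : Type u) (S' : Type v) [Fintype S] [Fintype S']
        (E : SignalStructure S) (E' : SignalStructure S') (m m' : ℕ), 2 ≤ m →
        kappa p < E.gamma ^ (m - 2) →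
        E.gamma ≤ E'.gamma → m ≤ m' → (E.gamma < E'.gamma ∨ m < m') →
        optimalPayoff p E m < optimalPayoff p E' m') ∧
    -- it tends to 1 as `gamma` tends to infinity
    (∀ m : ℕ, 3 ≤ m → ∀ ε : ℝ, 0 < ε → ∃ Γ : ℝ,
        ∀ (S : Type u) [Fintype S] (E : SignalStructure S), Γ < E.gamma →
          |optimalPayoff p E m - 1| < ε) ∧
    -- it tends to 1 as `m` tends to infinity
    (∀ (S : Type u) [Fintype S] (E : SignalStructure S),
        Tendsto (fun m : ℕ => optimalPayoff p E m) atTop (𝓝 1)) ∧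
    -- it tends to `max p (1 - p)` as `gamma ^ (m - 2)` decreases to `kappa`
    (∀ ε : ℝ, 0 < ε → ∃ δ : ℝ, 0 < δ ∧
        ∀ (S : Type u) [Fintype S] (E : SignalStructure S) (m : ℕ), 2 ≤ m →
          kappa p < E.gamma ^ (m - 2) → E.gamma ^ (m - 2) < kappa p + δ →
          |optimalPayoff p E m - max p (1 - p)| < ε) ∧
    -- (ii) otherwise it is the payoff from acting on the prior, which some protocol attains
    (∀ (S : Type u) [Fintype S] (E : SignalStructure S) (m : ℕ), 2 ≤ m →
        E.gamma ^ (m - 2) ≤ kappa p →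
        optimalPayoff p E m = max p (1 - p) ∧
        ∃ (P : Protocol m S) (c : ℝ), (c = 0 ∨ c = 1) ∧ (∀ i, P.a i = c) ∧
          receiverValue p E P = optimalPayoff p E m) := by
  refine ⟨fun S S' _ _ E E' m hm hg => ?_, fun S S' _ _ E E' m m' hm hk hg hmm hlt => ?_,
    fun m hm ε hε => ?_, fun S _ E => ?_, fun ε hε => ⟨ε, hε, fun S _ E m hm hk hd => ?_⟩,
    fun S _ E m hm hk => ?_⟩
  · rw [optimalPayoff_eq_frontierValue hp0 hp1 E hm, optimalPayoff_eq_frontierValue hp0 hp1 E' hm,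
      hg]
  · rw [optimalPayoff_eq_frontierValue hp0 hp1 E hm,
      optimalPayoff_eq_frontierValue hp0 hp1 E' (hm.trans hmm)]
    refine frontierValue_lt hp0 hp1 hk ?_
    have hγ := E.one_lt_gamma
    -- Since `kappa p ≥ 1`, the hypothesis excludes `m = 2`, where the power would not respond to
    -- `gamma`.
    have hm2 : m - 2 ≠ 0 := fun h => by
      rw [h, pow_zero] at hk
      exact absurd (one_le_kappa hp0 hp1) hk.not_ge
    rcases hlt with hlt | hlt
    · exact (pow_lt_pow_left₀ hlt (by linarith) hm2).trans_le
        (pow_le_pow_right₀ E'.one_lt_gamma.le (by omega))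
    · exact (pow_lt_pow_right₀ hγ (by omega)).trans_le (pow_le_pow_left₀ (by linarith) hg _)
  · obtain ⟨Γ, hΓ⟩ := eventually_atTop.1
      ((tendsto_frontierValue_atTop hp0 hp1).eventually (Metric.ball_mem_nhds 1 hε))
    refine ⟨Γ, fun S _ E hE => ?_⟩
    rw [optimalPayoff_eq_frontierValue hp0 hp1 E (by omega), ← Real.dist_eq]
    -- For `m ≥ 3` the power `gamma ^ (m - 2)` is at least `gamma`, so one threshold serves both.
    exact hΓ _ (hE.le.trans (le_self_pow₀ E.one_lt_gamma.le (by omega)))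
  · have h1 : Tendsto (fun m : ℕ => E.gamma ^ (m - 2)) atTop atTop :=
      (tendsto_pow_atTop_atTop_of_one_lt E.one_lt_gamma).comp (tendsto_sub_atTop_nat 2)
    refine ((tendsto_frontierValue_atTop hp0 hp1).comp h1).congr' ?_
    filter_upwards [eventually_ge_atTop 2] with m hm
      using (optimalPayoff_eq_frontierValue hp0 hp1 E hm).symm
  · have hK := one_le_kappa hp0 hp1
    have h1 := frontierValue_sub_le hp0 hp1 hK hk.le
    rw [frontierValue_of_le_kappa hp0 hp1 hK le_rfl] at h1
    have h2 := max_le_frontierValue p (one_pos.trans_le (hK.trans hk.le))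
    rw [optimalPayoff_eq_frontierValue hp0 hp1 E hm, abs_of_nonneg (sub_nonneg.2 h2)]
    linarith
  · have hV : optimalPayoff p E m = max p (1 - p) := by
      rw [optimalPayoff_eq_frontierValue hp0 hp1 E hm]
      exact frontierValue_of_le_kappa hp0 hp1 (one_le_pow₀ E.one_lt_gamma.le) hk
    refine ⟨hV, ?_⟩
    rw [hV]
    obtain ⟨n, rfl⟩ : ∃ n, m = n + 1 := ⟨m - 1, by omega⟩
    rcases le_total (1 - p) p with h | h
    · refine ⟨constProtocol S n (c := 1) (by simp), 1, Or.inr rfl, fun _ => rfl, ?_⟩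
      rw [receiverValue_constProtocol, max_eq_left h]
      ring
    · refine ⟨constProtocol S n (c := 0) (by simp), 0, Or.inl rfl, fun _ => rfl, ?_⟩
      rw [receiverValue_constProtocol, max_eq_right h]
      ring
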